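/- Conventions. Manifolds are smooth ($C^\infty$), finite-dimensional, without boundary, Hausdorff and second countable, and have a well-defined dimension. A distribution $\Delta$ on a manifold $M$ is a family of subspaces $\Delta_x\subset T_xM$ that is smooth: every $v\in\Delta_x$ is the value at $x$ of a smooth vector field defined near $x$ with values in $\Delta$. (Constant rank is not assumed.) An integral manifold of $\Delta$ is an injectively immersed manifold whose tangent space at each of its points is the value of $\Delta$ there. $\Delta$ is integrable if there is an integral manifold through every point of $M$; then $S_x$ denotes the maximal connected integral manifold through $x$, $M/\Delta$ is the set of all $S_x$ with the quotient topology, and $\mathbf q_\Delta:M\to M/\Delta$, $x\mapsto S_x$, is the projection. An integrable $\Delta$ is regular if $M/\Delta$ admits a unique manifold structure, compatible with the quotient topology, for which $\mathbf q_\Delta$ is a smooth submersion. A Lie group $G$ acting smoothly on $M$ acts regularly if the orbit space $M/G$, with the quotient topology, admits a manifold structure for which the projection $\mathbf q_G:M\to M/G$ is a smooth submersion. The action preserves $\Delta$ if $(\mu_g)_*\Delta_x=\Delta_{gx}$ for all $g\in G$, $x\in M$, where $\mu_g(x)=gx$; then $g\,S_x=S_{gx}$ defines an action of $G$ on $M/\Delta$,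 with projection $\tilde{\mathbf q}_G:M/\Delta\to (M/\Delta)/G$. Theorem. Let $G$ be a Lie group acting smoothly on the manifold $M$ and preserving the regular integrable distribution $\Delta$, and suppose that $G$ acts regularly on $M$ and on $M/\Delta$. Let $\mathbf p:M/G\to (M/\Delta)/G$ be the unique map with $\mathbf p\circ\mathbf q_G=\tilde{\mathbf q}_G\circ\mathbf q_\Delta$. Then (i) $\bar\Delta=\Delta/G:=\mathbf q_{G*}(\Delta)$ is a distribution on $M/G$ of constant rank, and it is integrable and regular; (ii) there is a unique diffeomorphism $\tau:(M/\Delta)/G\to (M/G)/\bar\Delta$ such that $$\tau\bigl(\tilde{\mathbf q}_G(\mathbf q_\Delta(x))\bigr)=\mathbf q_{\bar\Delta}(\mathbf q_G(x))\quad\text{for all }x\in M,$$ and it satisfies $\mathbf p=\tau^{-1}\circ \mathbf q_{\bar\Delta}$. -/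

import Mathlib

open Manifold
open scoped ContDiff Topology

noncomputable section

universe u

/-! ### Conventions

Smooth manifolds of dimension `n` are modelled on `EuclideanSpace ℝ (Fin n)` through the
boundaryless model `𝓘(ℝ, EuclideanSpace ℝ (Fin n))`; smooth means `C^∞`. -/

/-- The model space of smooth manifolds of dimension `n`. -/
abbrev Euc (n : ℕ) : Type := EuclideanSpace ℝ (Fin n)

/-- The (boundaryless) model with corners of smooth manifolds of dimension `n`. -/
abbrev Mdl (n : ℕ) : ModelWithCorners ℝ (Euc n) (Euc n) := 𝓘(ℝ, Euc n)

/-! ### Manifold structures on quotients -/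

/-- The given charts make `Q` (with its given topology) a Hausdorff smooth `k`-manifold such that
`q : M → Q` is a smooth submersion. -/
structure IsQuotientManifold (n k : ℕ) {M Q : Type*} [TopologicalSpace M] [ChartedSpace (Euc n) M]
    [TopologicalSpace Q] [ChartedSpace (Euc k) Q] (q : M → Q) : Prop where
  t2 : T2Space Q
  isManifold : IsManifold (Mdl k) ∞ Q
  isSubmersion : IsSubmersion (Mdl n) (Mdl k) ∞ q

/-- The topological space `Q` admits a manifold structure such that `q : M → Q` is a smooth
submersion. -/
def AdmitsQuotientManifold (n : ℕ) {M Q : Type*} [TopologicalSpace M] [ChartedSpace (Euc n) M]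
    [TopologicalSpace Q] (q : M → Q) : Prop :=
  ∃ (k : ℕ) (_ : ChartedSpace (Euc k) Q), IsQuotientManifold n k q

/-- Any two manifold structures on the topological space `Q` for which `q : M → Q` is a smooth
submersion agree, i.e. the identity of `Q` is smooth from each of them to the other. -/
def UniqueQuotientManifold (n : ℕ) {M Q : Type*} [TopologicalSpace M] [ChartedSpace (Euc n) M]
    [TopologicalSpace Q] (q : M → Q) : Prop :=
  ∀ (k k' : ℕ) (c : ChartedSpace (Euc k) Q) (c' : ChartedSpace (Euc k') Q),
    @IsQuotientManifold n k M Q _ _ _ c q → @IsQuotientManifold n k' M Q _ _ _ c' q →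
      @ContMDiff ℝ _ (Euc k) _ _ (Euc k) _ (Mdl k) Q _ c (Euc k') _ _ (Euc k') _ (Mdl k') Q _ c'
        ∞ (id : Q → Q)

/-! ### Group actions -/

/-- The canonical projection of `M` onto the space `M/G` of orbits, which carries the quotient
topology. -/
def orbitProj (G M : Type*) [Group G] [MulAction G M] : M → MulAction.orbitRel.Quotient G M :=
  Quotient.mk _

/-- The action of `G` on `M` is regular: `M/G`, with the quotient topology, admits a smooth
manifold structure such that `M → M/G` is a smooth submersion. -/
def IsRegularAction (G : Type*) (n : ℕ) (M : Type*) [Group G] [TopologicalSpace M]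
    [ChartedSpace (Euc n) M] [MulAction G M] : Prop :=
  AdmitsQuotientManifold n (orbitProj G M)

/-! ### Distributions -/

/-- A family of subspaces of the tangent spaces of the `n`-dimensional manifold `M`. No constancy
of the rank is required, and smoothness is the separate predicate `TangentDistribution.IsSmooth`. -/
abbrev TangentDistribution (n : ℕ) (M : Type*) [TopologicalSpace M] [ChartedSpace (Euc n) M] : Type _ :=
  (x : M) → Submodule ℝ (TangentSpace (Mdl n) x)

namespace TangentDistribution

section

variable {n : ℕ} {M : Type u} [TopologicalSpace M] [ChartedSpace (Euc n) M]

/-- `Δ` is smooth: every vector of `Δ` is the value of a smooth local vector field with values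
in `Δ`. -/
def IsSmooth [IsManifold (Mdl n) ∞ M] (Δ : TangentDistribution n M) : Prop :=
  ∀ x : M, ∀ v ∈ Δ x, ∃ U : Set M, IsOpen U ∧ x ∈ U ∧
    ∃ X : (y : M) → TangentSpace (Mdl n) y,
      ContMDiffOn (Mdl n) (Mdl n).tangent ∞
        (fun y ↦ (⟨y, X y⟩ : TangentBundle (Mdl n) M)) U ∧
      (∀ y ∈ U, X y ∈ Δ y) ∧ X x = v

/-- `Δ` has constant rank. -/
def HasConstantRank (Δ : TangentDistribution n M) : Prop :=
  ∃ r : ℕ, ∀ x : M, Module.finrank ℝ (Δ x) = r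

/-- `f : N → M` is an integral manifold of `Δ`: an injectively immersed manifold whose tangent
space at each point is the value of `Δ` at that point. -/
structure IsIntegralManifold (Δ : TangentDistribution n M) (r : ℕ) (N : Type u) [TopologicalSpace N]
    [ChartedSpace (Euc r) N] (f : N → M) : Prop where
  t2 : T2Space N
  secondCountable : SecondCountableTopology N
  isManifold : IsManifold (Mdl r) ∞ N
  injective : Function.Injective f
  isImmersion : IsImmersion (Mdl r) (Mdl n) ∞ f
  tangent : ∀ y : N, (mfderiv (Mdl r) (Mdl n) f y).range = Δ (f y)

/-- `Δ` is integrable: there is an integral manifold of `Δ` through every point. -/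
def IsIntegrable (Δ : TangentDistribution n M) : Prop :=
  ∀ x : M, ∃ (r : ℕ) (N : Type u) (_ : TopologicalSpace N) (_ : ChartedSpace (Euc r) N)
    (f : N → M), Δ.IsIntegralManifold r N f ∧ x ∈ Set.range f

/-- `x` and `y` lie on a common connected integral manifold of `Δ`. -/
def OnCommonIntegralManifold (Δ : TangentDistribution n M) (x y : M) : Prop :=
  ∃ (r : ℕ) (N : Type u) (_ : TopologicalSpace N) (_ : ChartedSpace (Euc r) N) (f : N → M),
    Δ.IsIntegralManifold r N f ∧ ConnectedSpace N ∧ x ∈ Set.range f ∧ y ∈ Set.range f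

/-- The equivalence relation whose classes are the maximal connected integral manifolds `S_x` of
`Δ`. For a smooth integrable `Δ` the union of two intersecting connected integral manifolds lies
in a connected integral manifold, so the relation `OnCommonIntegralManifold` is already an
equivalence relation, and the class of `x` is the maximal connected integral manifold through
`x`. -/
def leafSetoid (Δ : TangentDistribution n M) : Setoid M :=
  Relation.EqvGen.setoid Δ.OnCommonIntegralManifold

/-- The space `M/Δ` of maximal connected integral manifolds of `Δ`. -/
def LeafSpace (Δ : TangentDistribution n M) : Type u := Quotient Δ.leafSetoid

/-- `M/Δ` carries the quotient topology. -/
instance (Δ : TangentDistribution n M) : TopologicalSpace Δ.LeafSpace :=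
  inferInstanceAs (TopologicalSpace (Quotient Δ.leafSetoid))

/-- The canonical projection `M → M/Δ`, `x ↦ S_x`. -/
def leafProj (Δ : TangentDistribution n M) : M → Δ.LeafSpace := Quotient.mk Δ.leafSetoid

/-- `Δ` is regular: `M/Δ`, with the quotient topology, admits a unique smooth manifold structure
such that `M → M/Δ` is a smooth submersion. -/
def IsRegular (Δ : TangentDistribution n M) : Prop :=
  AdmitsQuotientManifold n Δ.leafProj ∧ UniqueQuotientManifold n Δ.leafProj

/-- `G` acts by smooth maps that preserve `Δ`: `(μ_g)_* Δ_x = Δ_{g x}` for all `g` and `x`. -/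
class IsInvariant (G : Type*) [Group G] [MulAction G M] (Δ : TangentDistribution n M) : Prop where
  contMDiff : ∀ g : G, ContMDiff (Mdl n) (Mdl n) ∞ (fun y : M ↦ g • y)
  map_eq : ∀ (g : G) (x : M),
    (Δ x).map (mfderiv (Mdl n) (Mdl n) (fun y : M ↦ g • y) x).toLinearMap = Δ (g • x)

/-- The image `q_*(Δ)` of `Δ` under a map `q : M → Q`: its value at `y` is spanned by the vectors
`q_* v` with `v ∈ Δ x` and `q x = y`. -/
def pushforward {k : ℕ} {Q : Type*} [TopologicalSpace Q] [ChartedSpace (Euc k) Q]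
    (Δ : TangentDistribution n M) (q : M → Q) : TangentDistribution k Q := fun y ↦
  Submodule.span ℝ {w | ∃ (x : M) (v : TangentSpace (Mdl n) x), v ∈ Δ x ∧
    tangentMap (Mdl n) (Mdl k) q ⟨x, v⟩ = ⟨y, w⟩}

/-- The distribution `Δ/G = (q_G)_*(Δ)` on `M/G`, where `q_G : M → M/G` is the projection. -/
def quotient (G : Type*) [Group G] [MulAction G M] (Δ : TangentDistribution n M) (k : ℕ)
    [ChartedSpace (Euc k) (MulAction.orbitRel.Quotient G M)] :
    TangentDistribution k (MulAction.orbitRel.Quotient G M) :=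
  Δ.pushforward (orbitProj G M)

end

/-! ### The induced action on the leaf space -/

section

variable {n : ℕ} {M : Type u} [TopologicalSpace M] [ChartedSpace (Euc n) M]

/-- The composition of an immersion with a diffeomorphism is an immersion. -/
theorem isImmersion_comp_diffeomorph [IsManifold (Mdl n) ∞ M] {r : ℕ} {N : Type*}
    [TopologicalSpace N] [ChartedSpace (Euc r) N] {f : N → M}
    (hf : IsImmersion (Mdl r) (Mdl n) ∞ f)
    (φ : M ≃ₘ^∞⟮Mdl n, Mdl n⟯ M) : IsImmersion (Mdl r) (Mdl n) ∞ (φ ∘ f) := by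
  obtain ⟨F, i1, i2, h⟩ := hf
  refine ⟨F, i1, i2, fun x ↦ ?_⟩
  have hx := h x
  let ψ : OpenPartialHomeomorph M (Euc n) :=
    φ.symm.toHomeomorph.toOpenPartialHomeomorph.trans hx.codChart
  have hψs : ∀ y, y ∈ ψ.source ↔ φ.symm y ∈ hx.codChart.source := by
    intro y; simp [ψ]
  refine IsImmersionAtOfComplement.mk_of_charts hx.equiv hx.domChart ψ
    hx.mem_domChart_source ?_ hx.domChart_mem_maximalAtlas ?_ ?_ ?_
  · rw [hψs]; simpa using hx.mem_codChart_source
  · rw [IsManifold.mem_maximalAtlas_iff_contMDiffOn]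
    have hc := (IsManifold.mem_maximalAtlas_iff_contMDiffOn _).1 hx.codChart_mem_maximalAtlas
    constructor
    · exact hc.1.comp φ.symm.contMDiff.contMDiffOn (fun y hy ↦ (hψs y).1 hy)
    · refine (φ.contMDiff.comp_contMDiffOn hc.2).mono ?_
      intro y hy
      simpa [ψ] using hy
  · intro y hy
    have := hx.source_subset_preimage_source hy
    change φ (f y) ∈ ψ.source
    rw [hψs]; simpa using this
  · intro z hz
    have := hx.writtenInCharts hz
    simpa [ψ] using this

variable [IsManifold (Mdl n) ∞ M] {G : Type*} [Group G] [MulAction G M]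

/-- An element of `G` maps integral manifolds of an invariant distribution to integral
manifolds. -/
theorem IsIntegralManifold.smul {Δ : TangentDistribution n M} [hΔ : Δ.IsInvariant G] {r : ℕ}
    {N : Type u} [TopologicalSpace N] [ChartedSpace (Euc r) N] {f : N → M}
    (hf : Δ.IsIntegralManifold r N f) (g : G) :
    Δ.IsIntegralManifold r N (fun y ↦ g • f y) where
  t2 := hf.t2
  secondCountable := hf.secondCountable
  isManifold := hf.isManifold
  injective := fun a b hab ↦ hf.injective (smul_left_cancel g hab)
  isImmersion := isImmersion_comp_diffeomorph hf.isImmersion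
    { toEquiv := MulAction.toPerm g
      contMDiff_toFun := hΔ.contMDiff g
      contMDiff_invFun := hΔ.contMDiff g⁻¹ }
  tangent := by
    intro y
    obtain ⟨F, i1, i2, h⟩ := hf.isImmersion
    have hd : MDifferentiableAt (Mdl r) (Mdl n) f y :=
      (h y).contMDiffAt.mdifferentiableAt (by simp)
    have hg : MDifferentiableAt (Mdl n) (Mdl n) (fun z : M ↦ g • z) (f y) :=
      (hΔ.contMDiff g).contMDiffAt.mdifferentiableAt (by simp)
    have hcomp := mfderiv_comp y hg hd
    change (mfderiv (Mdl r) (Mdl n) ((fun z : M ↦ g • z) ∘ f) y).range = _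
    rw [hcomp, ← hΔ.map_eq g (f y), ← hf.tangent y]
    exact LinearMap.range_comp _ _

/-- An element of `G` maps the maximal integral manifolds of an invariant distribution to maximal
integral manifolds. -/
theorem leafSetoid_smul {Δ : TangentDistribution n M} [Δ.IsInvariant G] (g : G) {x y : M}
    (h : Δ.leafSetoid x y) : Δ.leafSetoid (g • x) (g • y) := by
  induction h with
  | rel x y h =>
    obtain ⟨r, N, i1, i2, f, hf, hN, ⟨a, rfl⟩, ⟨b, rfl⟩⟩ := h
    exact Relation.EqvGen.rel _ _ ⟨r, N, i1, i2, _, hf.smul g, hN, ⟨a, rfl⟩, ⟨b, rfl⟩⟩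
  | refl x => exact Relation.EqvGen.refl _
  | symm x y _ ih => exact Relation.EqvGen.symm _ _ ih
  | trans x y z _ _ ih₁ ih₂ => exact Relation.EqvGen.trans _ _ _ ih₁ ih₂

/-- The induced action of `G` on `M/Δ`, given by `g S_x = S_{g x}`. -/
instance (Δ : TangentDistribution n M) [Δ.IsInvariant G] : MulAction G Δ.LeafSpace where
  smul g := Quotient.map (fun x ↦ g • x) (fun _ _ h ↦ leafSetoid_smul g h)
  one_smul := by
    rintro ⟨x⟩
    exact congrArg Δ.leafProj (one_smul G x)
  mul_smul := by
    rintro g h ⟨x⟩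
    exact congrArg Δ.leafProj (mul_smul g h x)

/-- The projection `M → M/Δ` is equivariant. -/
theorem leafProj_smul (Δ : TangentDistribution n M) [Δ.IsInvariant G] (g : G) (x : M) :
    Δ.leafProj (g • x) = g • Δ.leafProj x := rfl

/-- The map `p : M/G → (M/Δ)/G` induced by the composition `M → M/Δ → (M/Δ)/G`. -/
def descend (G : Type*) [Group G] [MulAction G M] (Δ : TangentDistribution n M)
    [Δ.IsInvariant G] :
    MulAction.orbitRel.Quotient G M → MulAction.orbitRel.Quotient G Δ.LeafSpace :=
  Quotient.lift (fun x ↦ orbitProj G Δ.LeafSpace (Δ.leafProj x)) (by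
    rintro _ y ⟨g, rfl⟩
    exact Quotient.sound ⟨g, rfl⟩)

/-- `p` makes the square with the projections `M → M/G` and `M → M/Δ → (M/Δ)/G` commute. -/
theorem descend_orbitProj (Δ : TangentDistribution n M) [Δ.IsInvariant G] (x : M) :
    Δ.descend G (orbitProj G M x) = orbitProj G Δ.LeafSpace (Δ.leafProj x) := rfl

end

end TangentDistribution

end

/-! Everything is read off from the map p : M/G → (M/Δ)/G, which is `Δ.descend G`. The composite M →
M/Δ → (M/Δ)/G is a surjective submersion that factors through M → M/G, so p is a surjective
submersion. Two facts then give the theorem: Δ/G is the kernel of dp (`ker_mfderiv_descend`), and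
the leaves of Δ/G are exactly the fibres of p (`leafProj_quotient_eq_iff`). By the first, the normal
form of a submersion shows that Δ/G is smooth, of constant rank and integrable. By the second, and
because p is open, p induces a homeomorphism from the leaf space of Δ/G onto (M/Δ)/G; the manifold
structure is transported along it, and τ is its inverse. Smoothness of τ, of its inverse, and of the
identity between two quotient structures is tested after composing with a surjective submersion.

A fibre of p is the image in M/G of a single leaf of Δ, because points with the same image under p
have representatives in one leaf. It is therefore connected, and a connected piece of a fibre of a
submersion stays in one leaf of the vertical distribution.

The kernel of dp is computed from two equalities of tangent spaces: the kernel of dq_Δ is Δ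
(`ker_mfderiv_leafProj`), and dq_Δ maps the kernel of dq_G onto the kernel of the derivative of M/Δ
→ (M/Δ)/G (`map_ker_mfderiv_orbitProj`). In both, one inclusion is differentiation and the other is
a count of Hausdorff dimensions: a fibre of a submersion contains, in a chart, an open piece of a
space of the dimension of the kernel, so the kernel has dimension at most ρ once the fibre is
covered by countably many images of maps of rank ρ. For the second equality the fibre is the image
of a G-orbit in M, along which equivariance makes the rank constant. For the first the fibre is a
leaf, which has to be covered by countably many pieces of integral manifolds
(`exists_countable_cover_leaf`).

Since the rank of Δ may jump, there are no Frobenius charts for that cover. Their substitute is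
`exists_localLeaf`: a local frame extending a basis of Δ at x spans Δ along nearby integral
manifolds of the same dimension, and a Gronwall estimate keeps such a manifold in the slice through
x once it meets it. Plaques of small basic open sets then lie in one integral manifold, each
integral manifold meets only countably many plaques of a given open set, and a leaf is exhausted by
chains of plaques. -/

noncomputable section

open Set Module

/-! ### Straightening and maps of constant rank in vector spaces -/

/-- Straightening of a map with surjective derivative: it is the first component of a local
diffeomorphism. -/
theorem exists_straightening {E D : Type*} [NormedAddCommGroup E] [NormedSpace ℝ E]
    [FiniteDimensional ℝ E] [NormedAddCommGroup D] [NormedSpace ℝ D] [FiniteDimensional ℝ D]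
    {d : ℕ} (hd : finrank ℝ D + d = finrank ℝ E) {g : E → D} {U : Set E} (hU : IsOpen U)
    (hg : ContDiffOn ℝ ∞ g U) {w : E} (hw : w ∈ U)
    (hs : Function.Surjective (fderiv ℝ g w)) :
    ∃ Φ : OpenPartialHomeomorph E (D × Euc d), w ∈ Φ.source ∧ Φ.source ⊆ U ∧
      (∀ x ∈ Φ.source, (Φ x).1 = g x) ∧ ContDiffOn ℝ ∞ Φ Φ.source ∧
      ContDiffOn ℝ ∞ Φ.symm Φ.target := by
  have : CompleteSpace E := FiniteDimensional.complete ℝ E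
  have : CompleteSpace D := FiniteDimensional.complete ℝ D
  have hsr : (fderiv ℝ g w).range = ⊤ := LinearMap.range_eq_top.2 hs
  have hker : finrank ℝ (fderiv ℝ g w).ker = d := by
    have := LinearMap.finrank_range_add_finrank_ker (fderiv ℝ g w).toLinearMap
    have h2 : finrank ℝ (fderiv ℝ g w).range = finrank ℝ D := by rw [hsr]; exact finrank_top ℝ D
    change finrank ℝ (fderiv ℝ g w).range + finrank ℝ (fderiv ℝ g w).ker = _ at this
    omega
  let e : (fderiv ℝ g w).ker ≃L[ℝ] Euc d :=
    ContinuousLinearEquiv.ofFinrankEq (by rw [hker]; simp)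
  obtain ⟨κ, hκ⟩ := Submodule.ClosedComplemented.of_finiteDimensional (fderiv ℝ g w).ker
  -- Pairing `g` with a projection onto the kernel of its derivative makes the derivative at `w`
  -- invertible, so the inverse function theorem applies.
  let π : E →L[ℝ] Euc d := e.toContinuousLinearMap.comp κ
  have hπ : π.range = ⊤ := by
    refine LinearMap.range_eq_top.2 fun b ↦ ⟨(e.symm b : E), ?_⟩
    change e (κ (e.symm b : E)) = b
    rw [hκ]; simp
  have hc : IsCompl (fderiv ℝ g w).ker π.ker := by
    have h1 : π.ker = κ.ker := by
      ext z
      change e (κ z) = 0 ↔ κ z = 0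
      simp
    rw [h1]
    exact LinearMap.isCompl_of_proj hκ
  let L : E ≃L[ℝ] D × Euc d := (fderiv ℝ g w).equivProdOfSurjectiveOfIsCompl π hsr hπ hc
  have hgw : ContDiffAt ℝ ∞ g w := hg.contDiffAt (hU.mem_nhds hw)
  let G : E → D × Euc d := fun x ↦ (g x, π x)
  have hG : ContDiffOn ℝ ∞ G U := hg.prodMk π.contDiff.contDiffOn
  have hGw : ContDiffAt ℝ ∞ G w := hG.contDiffAt (hU.mem_nhds hw)
  have hG' : HasFDerivAt G (L : E →L[ℝ] D × Euc d) w :=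
    (hgw.differentiableAt (by simp)).hasFDerivAt.prodMk π.hasFDerivAt
  let Φ₀ := hGw.toOpenPartialHomeomorph G hG' (by simp)
  have hΦ₀ : ∀ x, Φ₀ x = G x := fun x ↦ rfl
  -- Restricting to the open set where the derivative is invertible makes the inverse smooth on its
  -- whole domain, not only at the image of `w`.
  let V : Set E := {x | x ∈ U ∧ fderiv ℝ G x ∈ range ((↑) : (E ≃L[ℝ] D × Euc d) → E →L[ℝ] _)}
  have hV : IsOpen V := (hG.continuousOn_fderiv_of_isOpen hU (by simp)).isOpen_inter_preimage hU
    ContinuousLinearEquiv.isOpen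
  have hwV : w ∈ V := ⟨hw, L, hG'.fderiv.symm⟩
  have hsrc : (Φ₀.restrOpen V hV).source = Φ₀.source ∩ V := Φ₀.restrOpen_source V hV
  refine ⟨Φ₀.restrOpen V hV, ?_, ?_, fun x _ ↦ rfl, ?_, ?_⟩
  · rw [hsrc]; exact ⟨hGw.mem_toOpenPartialHomeomorph_source hG' (by simp), hwV⟩
  · rw [hsrc]; exact fun x hx ↦ hx.2.1
  · rw [hsrc]; exact hG.mono fun x hx ↦ hx.2.1
  · intro y hy
    have hx := (Φ₀.restrOpen V hV).map_target hy
    rw [hsrc] at hx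
    obtain ⟨-, hxU, L', hL'⟩ := hx
    have hx' : ContDiffAt ℝ ∞ G ((Φ₀.restrOpen V hV).symm y) := hG.contDiffAt (hU.mem_nhds hxU)
    refine ((Φ₀.restrOpen V hV).contDiffAt_symm (f₀' := L') hy ?_ hx').contDiffWithinAt
    have := (hx'.differentiableAt (by simp)).hasFDerivAt
    rw [← hL'] at this
    exact this

/-- The image of a small open set under a map of constant rank `ρ` has Hausdorff dimension at most
`ρ`. -/
theorem exists_nhds_dimH_image_le_of_rank_eq {E E' : Type*} [NormedAddCommGroup E]
    [NormedSpace ℝ E] [FiniteDimensional ℝ E] [NormedAddCommGroup E'] [NormedSpace ℝ E']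
    {g : E → E'} {U : Set E} (hU : IsOpen U)
    (hg : ContDiffOn ℝ ∞ g U) {ρ : ℕ} (hr : ∀ x ∈ U, finrank ℝ (fderiv ℝ g x).range = ρ)
    {w : E} (hw : w ∈ U) : ∃ W ∈ 𝓝 w, W ⊆ U ∧ dimH (g '' W) ≤ ρ := by
  -- Projecting to the range of the derivative at `w` turns `g` into a map that is submersive at `w`
  -- and can be straightened.
  obtain ⟨P, hP⟩ := Submodule.ClosedComplemented.of_finiteDimensional (fderiv ℝ g w).range
  have hD : finrank ℝ (fderiv ℝ g w).range = ρ := hr w hw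
  have hdiff : ∀ x ∈ U, HasFDerivAt g (fderiv ℝ g x) x := fun x hx ↦
    ((hg.contDiffAt (hU.mem_nhds hx)).differentiableAt (by simp)).hasFDerivAt
  have hPg : ∀ x ∈ U, HasFDerivAt (fun x ↦ P (g x)) (P.comp (fderiv ℝ g x)) x := fun x hx ↦
    P.hasFDerivAt.comp x (hdiff x hx)
  have hPgs : ContDiffOn ℝ ∞ (fun x ↦ P (g x)) U := P.contDiff.comp_contDiffOn hg
  have hsw : Function.Surjective (fderiv ℝ (fun x ↦ P (g x)) w) := by
    rw [(hPg w hw).fderiv]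
    rintro ⟨_, v, rfl⟩
    exact ⟨v, hP ⟨_, v, rfl⟩⟩
  obtain ⟨d, hd⟩ : ∃ d, finrank ℝ (fderiv ℝ g w).range + d = finrank ℝ E :=
    ⟨_, LinearMap.finrank_range_add_finrank_ker (fderiv ℝ g w).toLinearMap⟩
  obtain ⟨Φ, hwΦ, hΦU, hΦ1, hΦs, hΦs'⟩ := exists_straightening hd hU hPgs hw hsw
  -- the derivative of `g` vanishes on the kernel of the first component of `Φ`
  have hT : IsOpen Φ.target := Φ.open_target
  have hdΦ : ∀ y ∈ Φ.target, HasFDerivAt Φ.symm (fderiv ℝ Φ.symm y) y := fun y hy ↦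
    ((hΦs'.contDiffAt (hT.mem_nhds hy)).differentiableAt (by simp)).hasFDerivAt
  have hfst : ∀ y ∈ Φ.target, ∀ k, P (fderiv ℝ g (Φ.symm y) (fderiv ℝ Φ.symm y k)) = k.1 := by
    intro y hy k
    have h1 := (hPg _ (hΦU (Φ.map_target hy))).comp y (hdΦ y hy)
    have h2 : HasFDerivAt ((fun x ↦ P (g x)) ∘ Φ.symm) (ContinuousLinearMap.fst ℝ _ _) y := by
      refine hasFDerivAt_fst.congr_of_eventuallyEq ?_
      filter_upwards [hT.mem_nhds hy] with z hz
      have := hΦ1 _ (Φ.map_target hz)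
      rw [Φ.right_inv hz] at this
      exact this.symm
    exact congrArg (fun A ↦ A k) (h1.unique h2)
  have hzero : ∀ y ∈ Φ.target, ∀ k, k.1 = 0 → fderiv ℝ g (Φ.symm y) (fderiv ℝ Φ.symm y k) = 0 := by
    intro y hy k hk
    let R := (fderiv ℝ g (Φ.symm y)).range
    let PR : R →ₗ[ℝ] (fderiv ℝ g w).range := P.toLinearMap.comp R.subtype
    have hsurj : Function.Surjective PR := fun a ↦
      ⟨⟨_, fderiv ℝ Φ.symm y (a, 0), rfl⟩, hfst y hy (a, 0)⟩
    -- Constancy of the rank enters here: `P` maps the range of `dg` onto a space of the same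
    -- dimension, hence injectively, so what `P ∘ dg` kills is killed by `dg`.
    have hfr : finrank ℝ R = finrank ℝ (fderiv ℝ g w).range := by
      rw [hD]; exact hr _ (hΦU (Φ.map_target hy))
    have hinj : Function.Injective PR :=
      (LinearMap.injective_iff_surjective_of_finrank_eq_finrank hfr).2 hsurj
    have h0 : PR ⟨_, fderiv ℝ Φ.symm y k, rfl⟩ = PR 0 := by
      rw [map_zero]; exact (hfst y hy k).trans hk
    exact congrArg Subtype.val (hinj h0)
  -- on a product of balls `g ∘ Φ.symm` depends only on the first variable
  obtain ⟨ε, hε, hball⟩ := Metric.isOpen_iff.1 hT (Φ w) (Φ.map_source hwΦ)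
  set a := (Φ w).1 with ha
  set b := (Φ w).2 with hb
  have hprod : Metric.ball a ε ×ˢ Metric.ball b ε ⊆ Φ.target := by
    rw [ball_prod_same]; exact hball
  refine ⟨Φ.symm '' (Metric.ball a ε ×ˢ Metric.ball b ε), ?_, ?_, ?_⟩
  · have : Φ.symm '' (Metric.ball a ε ×ˢ Metric.ball b ε) ∈ 𝓝 (Φ.symm (Φ w)) := by
      refine Φ.symm.image_mem_nhds (Φ.map_source hwΦ) ?_
      exact (Metric.isOpen_ball.prod Metric.isOpen_ball).mem_nhds
        ⟨Metric.mem_ball_self hε, Metric.mem_ball_self hε⟩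
    rwa [Φ.left_inv hwΦ] at this
  · rintro _ ⟨y, hy, rfl⟩
    exact hΦU (Φ.map_target (hprod hy))
  · have hconst : ∀ s ∈ Metric.ball a ε, ∀ t ∈ Metric.ball b ε,
        g (Φ.symm (s, t)) = g (Φ.symm (s, b)) := by
      intro s hs t ht
      have hder : ∀ t ∈ Metric.ball b ε,
          HasFDerivAt (fun t ↦ g (Φ.symm (s, t))) (0 : Euc d →L[ℝ] E') t := by
        intro t ht
        have hy : (s, t) ∈ Φ.target := hprod ⟨hs, ht⟩
        have h1 := ((hdiff _ (hΦU (Φ.map_target hy))).comp (s, t) (hdΦ _ hy)).comp t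
          (hasFDerivAt_prodMk_right s t)
        refine h1.congr_fderiv ?_
        ext1 v
        exact hzero _ hy (0, v) rfl
      refine (convex_ball b ε).is_const_of_fderivWithin_eq_zero (𝕜 := ℝ)
        (f := fun t ↦ g (Φ.symm (s, t)))
        (fun t ht ↦ (hder t ht).differentiableAt.differentiableWithinAt) ?_ ht
        (Metric.mem_ball_self hε)
      intro t ht
      rw [fderivWithin_of_isOpen Metric.isOpen_ball ht]
      exact (hder t ht).fderiv
    have himg : g '' (Φ.symm '' (Metric.ball a ε ×ˢ Metric.ball b ε)) ⊆
        (fun s ↦ g (Φ.symm (s, b))) '' Metric.ball a ε := by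
      rintro _ ⟨_, ⟨⟨s, t⟩, ⟨hs, ht⟩, rfl⟩, rfl⟩
      exact ⟨s, hs, (hconst s hs t ht).symm⟩
    refine (dimH_mono himg).trans ?_
    -- A `C¹` image of a ball in a space of dimension `ρ` remains.
    have hsm : ContDiffOn ℝ 1 (fun s ↦ g (Φ.symm (s, b))) (Metric.ball a ε) := by
      refine ContDiffOn.of_le ?_ (by simp : (1 : WithTop ℕ∞) ≤ ∞)
      refine hg.comp (hΦs'.comp (contDiff_prodMk_left b).contDiffOn ?_) ?_
      · exact fun s hs ↦ hprod ⟨hs, Metric.mem_ball_self hε⟩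
      · exact fun s hs ↦ hΦU (Φ.map_target (hprod ⟨hs, Metric.mem_ball_self hε⟩))
    refine (hsm.dimH_image_le (convex_ball a ε) subset_rfl).trans ?_
    rw [← hD]
    exact (dimH_mono (subset_univ _)).trans (Real.dimH_univ_eq_finrank _).le

/-! ### Submersions: normal form, local sections, derivative criterion -/

section Submersions

variable {n k : ℕ} {M : Type*} [TopologicalSpace M] [ChartedSpace (Euc n) M]
  {N : Type*} [TopologicalSpace N] [ChartedSpace (Euc k) N]

/-- Normal form of a submersion near a point. -/
theorem Manifold.IsSubmersion.exists_normalForm {q : M → N}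
    (hq : IsSubmersion (Mdl n) (Mdl k) ∞ q) (x : M) :
    ∃ (d : ℕ) (L : Euc n ≃L[ℝ] Euc k × Euc d) (φ : OpenPartialHomeomorph M (Euc n))
      (ψ : OpenPartialHomeomorph N (Euc k)),
      φ ∈ IsManifold.maximalAtlas (Mdl n) ∞ M ∧ ψ ∈ IsManifold.maximalAtlas (Mdl k) ∞ N ∧
      x ∈ φ.source ∧ (∀ y ∈ φ.source, q y ∈ ψ.source) ∧
      ∀ y ∈ φ.source, ψ (q y) = (L (φ y)).1 := by
  obtain ⟨F, i1, i2, h⟩ := hq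
  have hx := h x
  -- The complement `F` is a priori any normed space; it embeds in the model space, so it may be
  -- replaced by some `Euc d`.
  have : FiniteDimensional ℝ F :=
    FiniteDimensional.of_injective
      (hx.equiv.symm.toLinearMap.comp (LinearMap.inr ℝ (Euc k) F)) fun a b hab ↦ by
        simpa using hab
  let e : F ≃L[ℝ] Euc (finrank ℝ F) := ContinuousLinearEquiv.ofFinrankEq (by simp)
  refine ⟨finrank ℝ F, hx.equiv.trans ((ContinuousLinearEquiv.refl ℝ _).prodCongr e),
    hx.domChart, hx.codChart, hx.domChart_mem_maximalAtlas, hx.codChart_mem_maximalAtlas,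
    hx.mem_domChart_source, fun y hy ↦ hx.source_subset_preimage_source hy, fun y hy ↦ ?_⟩
  have hy' : hx.domChart y ∈ (hx.domChart.extend (Mdl n)).target := by
    rw [OpenPartialHomeomorph.extend_target]; simpa using hx.domChart.map_source hy
  have := hx.writtenInCharts hy'
  simpa [hx.domChart.left_inv hy] using this

theorem Manifold.IsSubmersion.contMDiff' {q : M → N} (hq : IsSubmersion (Mdl n) (Mdl k) ∞ q) :
    ContMDiff (Mdl n) (Mdl k) ∞ q := by
  obtain ⟨F, i1, i2, h⟩ := hq
  exact fun x ↦ (h x).contMDiffAt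

theorem OpenPartialHomeomorph.mdifferentiable_of_mem_maximalAtlas
    {φ : OpenPartialHomeomorph M (Euc n)} (hφ : φ ∈ IsManifold.maximalAtlas (Mdl n) ∞ M) :
    φ.MDifferentiable (Mdl n) (Mdl n) :=
  ⟨(contMDiffOn_of_mem_maximalAtlas hφ).mdifferentiableOn (by simp),
    (contMDiffOn_symm_of_mem_maximalAtlas hφ).mdifferentiableOn (by simp)⟩

/-- A submersion has smooth local sections through every point. -/
theorem Manifold.IsSubmersion.exists_localSection {q : M → N}
    (hq : IsSubmersion (Mdl n) (Mdl k) ∞ q) (x : M) :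
    ∃ (s : N → M) (V : Set N), IsOpen V ∧ q x ∈ V ∧ s (q x) = x ∧
      ContMDiffOn (Mdl k) (Mdl n) ∞ s V ∧ ∀ y ∈ V, q (s y) = y := by
  obtain ⟨d, L, φ, ψ, hφ, hψ, hx, hsub, hq'⟩ := hq.exists_normalForm x
  -- The section freezes the fibre coordinate at its value at `x`.
  let c := (L (φ x)).2
  let j : Euc k → Euc n := fun a ↦ L.symm (a, c)
  have hj : ContDiff ℝ ∞ j := L.symm.contDiff.comp (contDiff_prodMk_left c)
  have hjo : IsOpen (ψ.source ∩ ψ ⁻¹' (j ⁻¹' φ.target)) :=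
    ψ.isOpen_inter_preimage (φ.open_target.preimage hj.continuous)
  have hjx : j (ψ (q x)) = φ x := by
    simp only [j, c, hq' x hx, Prod.mk.eta, ContinuousLinearEquiv.symm_apply_apply]
  refine ⟨fun y ↦ φ.symm (j (ψ y)), _, hjo, ⟨hsub x hx, ?_⟩, ?_, ?_, ?_⟩
  · simp only [mem_preimage]
    rw [hjx]; exact φ.map_source hx
  · simp only [hjx, φ.left_inv hx]
  · refine (contMDiffOn_symm_of_mem_maximalAtlas hφ).comp (t := φ.target)
      (f := fun y ↦ j (ψ y)) ?_ (fun y hy ↦ hy.2)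
    exact hj.contMDiff.comp_contMDiffOn
      ((contMDiffOn_of_mem_maximalAtlas hψ).mono fun y hy ↦ hy.1)
  · intro y hy
    have h1 := φ.map_target hy.2
    refine ψ.injOn (hsub _ h1) hy.1 ?_
    rw [hq' _ h1, φ.right_inv hy.2]
    simp [j]

variable [IsManifold (Mdl n) ∞ M] [IsManifold (Mdl k) ∞ N]

/-- A local section `s` through `x` gives a right inverse: `dq ∘ ds = id`. -/
theorem Manifold.IsSubmersion.mfderiv_surjective {q : M → N}
    (hq : IsSubmersion (Mdl n) (Mdl k) ∞ q) (x : M) :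
    Function.Surjective (mfderiv (Mdl n) (Mdl k) q x) := by
  obtain ⟨s, V, hV, hxV, hsx, hs, hqs⟩ := hq.exists_localSection x
  have h1 : HasMFDerivAt (Mdl k) (Mdl k) (q ∘ s) (q x) (ContinuousLinearMap.id ℝ _) := by
    refine (hasMFDerivAt_id (q x)).congr_of_eventuallyEq ?_
    filter_upwards [hV.mem_nhds hxV] with y hy using hqs y hy
  have hs' : MDifferentiableAt (Mdl k) (Mdl n) s (q x) :=
    (hs.contMDiffAt (hV.mem_nhds hxV)).mdifferentiableAt (by simp)
  have hq' : MDifferentiableAt (Mdl n) (Mdl k) q (s (q x)) :=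
    hq.contMDiff'.contMDiffAt.mdifferentiableAt (by simp)
  have h2 := (hq'.hasMFDerivAt.comp (q x) hs'.hasMFDerivAt).mfderiv
  rw [h1.mfderiv] at h2
  have key : ∀ x', x' = x → ∀ v : Euc k, v ∈ range (mfderiv (Mdl n) (Mdl k) q x') →
      v ∈ range (mfderiv (Mdl n) (Mdl k) q x) := by
    rintro _ rfl v hv; exact hv
  intro v
  refine key _ hsx v ⟨mfderiv (Mdl k) (Mdl n) s (q x) v, ?_⟩
  exact (congrArg (fun A ↦ A v) h2).symm

/-- A continuous local section through `x` carries points near `q x` into any given neighbourhood of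
`x`. -/
theorem Manifold.IsSubmersion.isOpenMap {q : M → N}
    (hq : IsSubmersion (Mdl n) (Mdl k) ∞ q) : IsOpenMap q := by
  rw [isOpenMap_iff_nhds_le]
  intro x S hS
  obtain ⟨s, V, hV, hxV, hsx, hs, hqs⟩ := hq.exists_localSection x
  have hc : ContinuousAt s (q x) := (hs.contMDiffAt (hV.mem_nhds hxV)).continuousAt
  rw [ContinuousAt, hsx] at hc
  filter_upwards [hc hS, hV.mem_nhds hxV] with y hy hyV
  have : q (s y) ∈ S := hy
  rwa [hqs y hyV] at this

/-- A map whose composition with a surjective submersion is smooth is smooth. -/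
theorem Manifold.IsSubmersion.contMDiff_of_comp {q : M → N}
    (hq : IsSubmersion (Mdl n) (Mdl k) ∞ q) (hsurj : Function.Surjective q)
    {m : ℕ} {P : Type*} [TopologicalSpace P] [ChartedSpace (Euc m) P] {f : N → P}
    (hf : ContMDiff (Mdl n) (Mdl m) ∞ (f ∘ q)) : ContMDiff (Mdl k) (Mdl m) ∞ f := by
  intro y
  obtain ⟨x, rfl⟩ := hsurj y
  obtain ⟨s, V, hV, hxV, hsx, hs, hqs⟩ := hq.exists_localSection x
  have h1 : ContMDiffAt (Mdl k) (Mdl m) ∞ ((f ∘ q) ∘ s) (q x) :=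
    hf.contMDiffAt.comp (q x) (hs.contMDiffAt (hV.mem_nhds hxV))
  refine h1.congr_of_eventuallyEq ?_
  filter_upwards [hV.mem_nhds hxV] with z hz
  simp [hqs z hz]

theorem Manifold.IsSubmersion.finrank_ker {q : M → N}
    (hq : IsSubmersion (Mdl n) (Mdl k) ∞ q) (x : M) :
    k + finrank ℝ (mfderiv (Mdl n) (Mdl k) q x).ker = n := by
  let A : Euc n →L[ℝ] Euc k := mfderiv (Mdl n) (Mdl k) q x
  have hA : A.range = ⊤ := LinearMap.range_eq_top.2 (hq.mfderiv_surjective x)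
  have h1 := LinearMap.finrank_range_add_finrank_ker A.toLinearMap
  have h2 : finrank ℝ A.range = k := by rw [hA, finrank_top]; simp
  have h3 : finrank ℝ (Euc n) = n := by simp
  rw [h3] at h1
  change finrank ℝ A.range + finrank ℝ A.ker = n at h1
  rw [h2] at h1
  exact h1

/-- A smooth map between manifolds with surjective derivatives is a submersion. -/
theorem Manifold.IsSubmersion.of_mfderiv_surjective {q : M → N}
    (hq : ContMDiff (Mdl n) (Mdl k) ∞ q)
    (hs : ∀ x, Function.Surjective (mfderiv (Mdl n) (Mdl k) q x)) :
    IsSubmersion (Mdl n) (Mdl k) ∞ q := by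
  -- The inequality `k ≤ n` needs a point of `M`; without points any complement will do.
  rcases isEmpty_or_nonempty M with hM | ⟨⟨x₀⟩⟩
  · exact ⟨PUnit, inferInstance, inferInstance, fun x ↦ hM.elim x⟩
  have hkn : k ≤ n := by
    let A : Euc n →L[ℝ] Euc k := mfderiv (Mdl n) (Mdl k) q x₀
    have := LinearMap.finrank_le_finrank_of_surjective (f := A.toLinearMap) (hs x₀)
    simpa using this
  obtain ⟨d, rfl⟩ := Nat.exists_eq_add_of_le hkn
  refine ⟨Euc d, inferInstance, inferInstance, fun x ↦ ?_⟩
  let φ := chartAt (Euc (k + d)) x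
  let ψ := chartAt (Euc k) (q x)
  have hφ : φ ∈ IsManifold.maximalAtlas (Mdl (k + d)) ∞ M := IsManifold.chart_mem_maximalAtlas x
  have hψ : ψ ∈ IsManifold.maximalAtlas (Mdl k) ∞ N := IsManifold.chart_mem_maximalAtlas _
  have hxφ : x ∈ φ.source := mem_chart_source _ x
  have hxψ : q x ∈ ψ.source := mem_chart_source _ _
  let U : Set (Euc (k + d)) := φ.target ∩ φ.symm ⁻¹' (q ⁻¹' ψ.source)
  have hU : IsOpen U :=
    φ.isOpen_inter_preimage_symm (ψ.open_source.preimage hq.continuous)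
  let g : Euc (k + d) → Euc k := fun z ↦ ψ (q (φ.symm z))
  have hxU : φ x ∈ U := ⟨φ.map_source hxφ, by
    simp only [mem_preimage, φ.left_inv hxφ]; exact hxψ⟩
  have hg : ContDiffOn ℝ ∞ g U := by
    rw [← contMDiffOn_iff_contDiffOn]
    refine (contMDiffOn_of_mem_maximalAtlas hψ).comp (t := ψ.source) ?_ (fun z hz ↦ hz.2)
    exact hq.comp_contMDiffOn ((contMDiffOn_symm_of_mem_maximalAtlas hφ).mono fun z hz ↦ hz.1)
  have hφd := OpenPartialHomeomorph.mdifferentiable_of_mem_maximalAtlas hφ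
  have hψd := OpenPartialHomeomorph.mdifferentiable_of_mem_maximalAtlas hψ
  have hgs : Function.Surjective (fderiv ℝ g (φ x)) := by
    have e1 : φ.symm (φ x) = x := φ.left_inv hxφ
    have h1 := (hφd.mdifferentiableAt_symm (φ.map_source hxφ)).hasMFDerivAt
    have h2 : HasMFDerivAt (Mdl (k+d)) (Mdl k) q (φ.symm (φ x)) _ :=
      (hq.contMDiffAt.mdifferentiableAt (by simp)).hasMFDerivAt
    have h3 : HasMFDerivAt (Mdl k) (Mdl k) ψ (q (φ.symm (φ x))) _ :=
      (hψd.mdifferentiableAt (by rw [e1]; exact hxψ)).hasMFDerivAt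
    have h4 := (h3.comp (φ x) (h2.comp (φ x) h1)).mfderiv
    change mfderiv _ _ g (φ x) = _ at h4
    rw [mfderiv_eq_fderiv] at h4
    rw [h4]
    exact (hψd.mfderiv_surjective (by rw [e1]; exact hxψ)).comp
      ((hs _).comp (hφd.symm.mfderiv_surjective (φ.map_source hxφ)))
  -- Composing the chart `φ` with the straightening of `q` in charts turns `q` into the first
  -- projection.
  obtain ⟨Φ, hxΦ, hΦU, hΦ1, hΦs, hΦs'⟩ := exists_straightening (d := d) (by simp) hU hg hxU hgs
  let L : Euc (k + d) ≃L[ℝ] Euc k × Euc d := ContinuousLinearEquiv.ofFinrankEq (by simp)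
  let χ : OpenPartialHomeomorph M (Euc (k + d)) :=
    (φ.trans Φ).trans L.symm.toHomeomorph.toOpenPartialHomeomorph
  have hχs : ∀ y, y ∈ χ.source ↔ y ∈ φ.source ∧ φ y ∈ Φ.source := by
    intro y; simp [χ]
  have hχ : ∀ y, χ y = L.symm (Φ (φ y)) := fun y ↦ rfl
  refine IsSubmersionAtOfComplement.mk_of_charts L χ ψ ?_ hxψ ?_ hψ ?_ ?_
  · exact (hχs x).2 ⟨hxφ, hxΦ⟩
  · rw [IsManifold.mem_maximalAtlas_iff_contMDiffOn]
    constructor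
    · refine L.symm.contDiff.contMDiff.comp_contMDiffOn ?_
      refine (hΦs.contMDiffOn).comp ((contMDiffOn_of_mem_maximalAtlas hφ).mono ?_) ?_
      · exact fun y hy ↦ ((hχs y).1 hy).1
      · exact fun y hy ↦ ((hχs y).1 hy).2
    · have ht : ∀ z ∈ χ.target, L z ∈ Φ.target ∧ Φ.symm (L z) ∈ φ.target := by
        intro z hz
        simpa [χ] using hz
      refine (contMDiffOn_symm_of_mem_maximalAtlas hφ).comp (t := φ.target)
        (f := fun z ↦ Φ.symm (L z)) ?_ (fun z hz ↦ (ht z hz).2)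
      exact hΦs'.contMDiffOn.comp L.contDiff.contMDiff.contMDiffOn (fun z hz ↦ (ht z hz).1)
  · intro y hy
    have := hΦU ((hχs y).1 hy).2
    simpa [φ.left_inv ((hχs y).1 hy).1] using this.2
  · intro z hz
    have hz' : z ∈ χ.target := by simpa using hz
    have hy := χ.map_target hz'
    obtain ⟨hy1, hy2⟩ := (hχs _).1 hy
    have h1 := hΦ1 _ hy2
    have h2 : L z = Φ (φ (χ.symm z)) := by
      have := hχ (χ.symm z)
      rw [χ.right_inv hz'] at this
      exact (congrArg L this).trans (L.apply_symm_apply _)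
    simp only [Function.comp_apply, mfld_simps]
    rw [h2, h1]
    simp only [g, φ.left_inv hy1]

end Submersions

/-! ### Slices of charts -/

section Slices

variable {n k : ℕ} {M : Type*} [TopologicalSpace M]

/-- The slice `t ↦ φ⁻¹ (c, t)` of a chart `φ`, with respect to a splitting of the model space. -/
def chartSlice {d : ℕ} (L : Euc n ≃L[ℝ] Euc k × Euc d) (φ : OpenPartialHomeomorph M (Euc n))
    (c : Euc k) (t : Euc d) : M := φ.symm (L.symm (c, t))

/-- The parameters for which the slice of a chart is defined. -/
def chartSliceSource {d : ℕ} (L : Euc n ≃L[ℝ] Euc k × Euc d)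
    (φ : OpenPartialHomeomorph M (Euc n)) (c : Euc k) : Set (Euc d) :=
  {t | L.symm (c, t) ∈ φ.target}

variable {d : ℕ} {L : Euc n ≃L[ℝ] Euc k × Euc d} {φ : OpenPartialHomeomorph M (Euc n)}

theorem isOpen_chartSliceSource (c : Euc k) : IsOpen (chartSliceSource L φ c) :=
  φ.open_target.preimage (by fun_prop : Continuous fun t ↦ L.symm (c, t))

theorem chartSlice_mem_source {c : Euc k} {t : Euc d} (ht : t ∈ chartSliceSource L φ c) :
    chartSlice L φ c t ∈ φ.source := φ.map_target ht

theorem apply_chartSlice {c : Euc k} {t : Euc d} (ht : t ∈ chartSliceSource L φ c) :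
    L (φ (chartSlice L φ c t)) = (c, t) := by
  rw [chartSlice, φ.right_inv ht, L.apply_symm_apply]

theorem mem_chartSliceSource {x : M} (hx : x ∈ φ.source) :
    (L (φ x)).2 ∈ chartSliceSource L φ (L (φ x)).1 := by
  simpa [chartSliceSource] using φ.map_source hx

theorem chartSlice_apply {x : M} (hx : x ∈ φ.source) :
    chartSlice L φ (L (φ x)).1 (L (φ x)).2 = x := by
  simp [chartSlice, φ.left_inv hx]

variable [ChartedSpace (Euc n) M]

theorem contMDiffOn_chartSlice (hφ : φ ∈ IsManifold.maximalAtlas (Mdl n) ∞ M) (c : Euc k) :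
    ContMDiffOn (Mdl d) (Mdl n) ∞ (chartSlice L φ c) (chartSliceSource L φ c) := by
  refine (contMDiffOn_symm_of_mem_maximalAtlas hφ).comp (t := φ.target)
    (f := fun t ↦ L.symm (c, t)) ?_ (fun t ht ↦ ht)
  exact (L.symm.contDiff.comp (contDiff_prodMk_right c)).contMDiff.contMDiffOn

variable [IsManifold (Mdl n) ∞ M]

/-- The derivative of a slice, seen in the chart. -/
theorem apply_mfderiv_chartSlice (hφ : φ ∈ IsManifold.maximalAtlas (Mdl n) ∞ M) {c : Euc k}
    {t : Euc d} (ht : t ∈ chartSliceSource L φ c) (v : Euc d) :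
    L (mfderiv (Mdl n) (Mdl n) φ (chartSlice L φ c t)
      (mfderiv (Mdl d) (Mdl n) (chartSlice L φ c) t v)) = (0, v) := by
  have hφd := OpenPartialHomeomorph.mdifferentiable_of_mem_maximalAtlas hφ
  have h1 : HasMFDerivAt (Mdl d) (Mdl n) (chartSlice L φ c) t _ :=
    (((contMDiffOn_chartSlice hφ c).contMDiffAt
      ((isOpen_chartSliceSource c).mem_nhds ht)).mdifferentiableAt (by simp)).hasMFDerivAt
  have h2 := (hφd.mdifferentiableAt (chartSlice_mem_source ht)).hasMFDerivAt.comp t h1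
  have h3 : HasFDerivAt (fun t : Euc d ↦ L.symm (c, t))
      (L.symm.toContinuousLinearMap.comp (ContinuousLinearMap.inr ℝ (Euc k) (Euc d))) t :=
    L.symm.toContinuousLinearMap.hasFDerivAt.comp t (hasFDerivAt_prodMk_right c t)
  have h4 : HasMFDerivAt (Mdl d) (Mdl n) (φ ∘ chartSlice L φ c) t
      (L.symm.toContinuousLinearMap.comp (ContinuousLinearMap.inr ℝ (Euc k) (Euc d))) := by
    refine h3.hasMFDerivAt.congr_of_eventuallyEq ?_
    filter_upwards [(isOpen_chartSliceSource c).mem_nhds ht] with s hs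
    exact φ.right_inv hs
  have h5 := congrArg (fun A ↦ L (A v)) (hasMFDerivAt_unique h2 h4)
  refine Eq.trans h5 ?_
  change L (L.symm ((0 : Euc k), v)) = (0, v)
  simp

/-- The derivative of `φ` is injective, so a vector whose first chart component vanishes is the
image of its second component. -/
theorem range_mfderiv_chartSlice (hφ : φ ∈ IsManifold.maximalAtlas (Mdl n) ∞ M) {c : Euc k}
    {t : Euc d} (ht : t ∈ chartSliceSource L φ c) (v : TangentSpace (Mdl n) (chartSlice L φ c t)) :
    v ∈ (mfderiv (Mdl d) (Mdl n) (chartSlice L φ c) t).range ↔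
      (L (mfderiv (Mdl n) (Mdl n) φ (chartSlice L φ c t) v)).1 = 0 := by
  have hφd := OpenPartialHomeomorph.mdifferentiable_of_mem_maximalAtlas hφ
  constructor
  · rintro ⟨w, rfl⟩
    exact congrArg Prod.fst (apply_mfderiv_chartSlice hφ ht w)
  · intro hv
    refine ⟨(L (mfderiv (Mdl n) (Mdl n) φ (chartSlice L φ c t) v)).2, ?_⟩
    refine hφd.mfderiv_injective (chartSlice_mem_source ht) ?_
    apply L.injective
    refine (apply_mfderiv_chartSlice hφ ht _).trans ?_
    exact Prod.ext hv.symm rfl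

end Slices

/-! ### Hausdorff dimension of subsets of manifolds -/

section Dimension

variable {n k : ℕ} {M : Type*} [TopologicalSpace M] [ChartedSpace (Euc n) M]
  {N : Type*} [TopologicalSpace N] [ChartedSpace (Euc k) N]

/-- The subset `S` of a manifold has Hausdorff dimension at most `ρ`, measured in charts. -/
def ManifoldDimLE (n : ℕ) {M : Type*} [TopologicalSpace M] [ChartedSpace (Euc n) M] (ρ : ℕ)
    (S : Set M) : Prop :=
  ∀ φ ∈ IsManifold.maximalAtlas (Mdl n) ∞ M, dimH (φ '' (S ∩ φ.source)) ≤ ρ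

theorem ManifoldDimLE.mono {ρ : ℕ} {S T : Set M} (hT : ManifoldDimLE n ρ T) (hST : S ⊆ T) :
    ManifoldDimLE n ρ S := fun φ hφ ↦
  (dimH_mono (image_mono (inter_subset_inter_left _ hST))).trans (hT φ hφ)

theorem ManifoldDimLE.biUnion {ρ : ℕ} {ι : Type*} {I : Set ι} (hI : I.Countable) {S : ι → Set M}
    (hS : ∀ i ∈ I, ManifoldDimLE n ρ (S i)) : ManifoldDimLE n ρ (⋃ i ∈ I, S i) := by
  intro φ hφ
  rw [iUnion₂_inter, image_iUnion₂, dimH_bUnion hI]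
  exact iSup₂_le fun i hi ↦ hS i hi φ hφ

/-- By second countability of the source, countably many of the neighbourhoods cover `A`, and
Hausdorff dimension is a supremum over countable unions. -/
theorem ManifoldDimLE.of_locally {X : Type*} [TopologicalSpace X] [SecondCountableTopology X]
    {ρ : ℕ} {f : X → M} {A : Set X}
    (h : ∀ x ∈ A, ∃ W ∈ 𝓝 x, ManifoldDimLE n ρ (f '' (A ∩ W))) : ManifoldDimLE n ρ (f '' A) := by
  choose! W hW hdim using h
  obtain ⟨t, htA, ht, hcov⟩ := TopologicalSpace.countable_cover_nhdsWithin
    (f := W) (s := A) fun x hx ↦ mem_nhdsWithin_of_mem_nhds (hW x hx)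
  refine (ManifoldDimLE.biUnion ht (S := fun x ↦ f '' (A ∩ W x))
    fun x hx ↦ hdim x (htA hx)).mono ?_
  rintro _ ⟨x, hx, rfl⟩
  obtain ⟨y, hy, hxy⟩ := mem_iUnion₂.1 (hcov hx)
  exact mem_iUnion₂.2 ⟨y, hy, x, ⟨hx, hxy⟩, rfl⟩

variable [IsManifold (Mdl n) ∞ M] [IsManifold (Mdl k) ∞ N]

/-- The image of a map of constant rank `ρ` has dimension at most `ρ`. -/
theorem manifoldDimLE_image_of_rank_eq [SecondCountableTopology N] {f : N → M} {U : Set N}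
    (hU : IsOpen U) (hf : ContMDiffOn (Mdl k) (Mdl n) ∞ f U) {ρ : ℕ}
    (hr : ∀ y ∈ U, finrank ℝ (mfderiv (Mdl k) (Mdl n) f y).range = ρ) :
    ManifoldDimLE n ρ (f '' U) := by
  intro φ hφ
  have hφd := OpenPartialHomeomorph.mdifferentiable_of_mem_maximalAtlas hφ
  let V : Set N := U ∩ f ⁻¹' φ.source
  have hV : IsOpen V := hf.continuousOn.isOpen_inter_preimage hU φ.open_source
  have himg : φ '' (f '' U ∩ φ.source) ⊆ (fun y ↦ φ (f y)) '' V := by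
    rintro _ ⟨_, ⟨⟨y, hy, rfl⟩, hyφ⟩, rfl⟩
    exact ⟨y, ⟨hy, hyφ⟩, rfl⟩
  refine (dimH_mono himg).trans ?_
  have hloc : ∀ w ∈ V, ∃ W ∈ 𝓝 w, dimH ((fun y ↦ φ (f y)) '' W) ≤ ρ := by
    intro w hw
    let χ := chartAt (Euc k) w
    have hχ : χ ∈ IsManifold.maximalAtlas (Mdl k) ∞ N := IsManifold.chart_mem_maximalAtlas w
    have hχd := OpenPartialHomeomorph.mdifferentiable_of_mem_maximalAtlas hχ
    have hwχ : w ∈ χ.source := mem_chart_source _ w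
    let g : Euc k → Euc n := fun z ↦ φ (f (χ.symm z))
    let T : Set (Euc k) := χ.target ∩ χ.symm ⁻¹' V
    have hT : IsOpen T := χ.isOpen_inter_preimage_symm hV
    have hg : ContDiffOn ℝ ∞ g T := by
      rw [← contMDiffOn_iff_contDiffOn]
      refine (contMDiffOn_of_mem_maximalAtlas hφ).comp (t := φ.source) ?_ (fun z hz ↦ hz.2.2)
      exact hf.comp ((contMDiffOn_symm_of_mem_maximalAtlas hχ).mono fun z hz ↦ hz.1)
        (fun z hz ↦ hz.2.1)
    have hgr : ∀ z ∈ T, finrank ℝ (fderiv ℝ g z).range = ρ := by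
      intro z hz
      have h1 := (hχd.mdifferentiableAt_symm hz.1).hasMFDerivAt
      have h2 : HasMFDerivAt (Mdl k) (Mdl n) f (χ.symm z) _ :=
        ((hf.contMDiffAt (hU.mem_nhds hz.2.1)).mdifferentiableAt (by simp)).hasMFDerivAt
      have h3 := (hφd.mdifferentiableAt hz.2.2).hasMFDerivAt
      have h4 := (h3.comp z (h2.comp z h1)).mfderiv
      change mfderiv _ _ g z = _ at h4
      rw [mfderiv_eq_fderiv] at h4
      rw [h4, ← hr _ hz.2.1]
      -- Passing to charts does not change the rank: `A` is surjective and `C` is injective.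
      let A : Euc k →L[ℝ] Euc k := mfderiv (Mdl k) (Mdl k) χ.symm z
      let B : Euc k →L[ℝ] Euc n := mfderiv (Mdl k) (Mdl n) f (χ.symm z)
      let C : Euc n →L[ℝ] Euc n := mfderiv (Mdl n) (Mdl n) φ (f (χ.symm z))
      have hA : A.toLinearMap.range = ⊤ :=
        LinearMap.range_eq_top.2 (hχd.symm.mfderiv_surjective hz.1)
      have hC : Function.Injective C := hφd.mfderiv_injective hz.2.2
      change finrank ℝ (C.toLinearMap.comp (B.toLinearMap.comp A.toLinearMap)).range =
        finrank ℝ B.toLinearMap.range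
      rw [LinearMap.range_comp, LinearMap.range_comp, hA, Submodule.map_top]
      exact (Submodule.equivMapOfInjective C.toLinearMap hC _).finrank_eq.symm
    obtain ⟨W, hW, hWT, hdim⟩ := exists_nhds_dimH_image_le_of_rank_eq hT hg hgr (w := χ w)
      ⟨χ.map_source hwχ, by simpa only [mem_preimage, χ.left_inv hwχ] using hw⟩
    refine ⟨χ.source ∩ χ ⁻¹' W, ?_, (dimH_mono ?_).trans hdim⟩
    · exact Filter.inter_mem (χ.open_source.mem_nhds hwχ) (χ.continuousAt hwχ hW)
    · rintro _ ⟨y, hy, rfl⟩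
      exact ⟨χ y, hy.2, by simp only [g, χ.left_inv hy.1]⟩
  choose! W hW hdim using hloc
  obtain ⟨t, htA, ht, hcov⟩ := TopologicalSpace.countable_cover_nhdsWithin
    (f := W) (s := V) fun x hx ↦ mem_nhdsWithin_of_mem_nhds (hW x hx)
  refine (dimH_mono (image_mono hcov)).trans ?_
  rw [image_iUnion₂, dimH_bUnion ht]
  exact iSup₂_le fun i hi ↦ hdim i (htA hi)

/-- If a fibre of a submersion has dimension at most `ρ`, then so does the kernel of the
derivative. -/
theorem Manifold.IsSubmersion.finrank_ker_le {q : M → N}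
    (hq : IsSubmersion (Mdl n) (Mdl k) ∞ q) (x : M) {ρ : ℕ}
    (h : ManifoldDimLE n ρ (q ⁻¹' {q x})) :
    finrank ℝ (mfderiv (Mdl n) (Mdl k) q x).ker ≤ ρ := by
  obtain ⟨d, L, φ, ψ, hφ, hψ, hx, hsub, hq'⟩ := hq.exists_normalForm x
  have hd : finrank ℝ (mfderiv (Mdl n) (Mdl k) q x).ker = d := by
    have h1 := hq.finrank_ker x
    have h2 := L.toLinearEquiv.finrank_eq
    simp only [finrank_euclideanSpace, Fintype.card_fin, finrank_prod] at h2
    omega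
  rw [hd]
  let c := (L (φ x)).1
  -- The slice through `x` lies in the fibre; its parameters form an open subset of `Euc d` and are
  -- recovered from the fibre by a Lipschitz projection, which does not raise dimension.
  have hsub' : chartSliceSource L φ c ⊆
      (fun z ↦ (L z).2) '' (φ '' (q ⁻¹' {q x} ∩ φ.source)) := by
    intro t ht
    have h1 := chartSlice_mem_source ht
    have h2 := apply_chartSlice ht
    refine ⟨_, ⟨_, ⟨?_, h1⟩, rfl⟩, congrArg Prod.snd h2⟩
    refine ψ.injOn (hsub _ h1) (hsub _ hx) ?_
    rw [hq' _ h1, hq' _ hx, h2]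
  have h1 : dimH (chartSliceSource L φ c) = d := by
    rw [Real.dimH_of_mem_nhds ((isOpen_chartSliceSource c).mem_nhds (mem_chartSliceSource hx))]
    simp
  have h2 : LipschitzWith _ (fun z ↦ (L z).2) :=
    ((ContinuousLinearMap.snd ℝ (Euc k) (Euc d)).comp L.toContinuousLinearMap).lipschitz
  have h3 := ((dimH_mono hsub').trans (h2.dimH_image_le _)).trans (h φ hφ)
  rw [h1] at h3
  exact_mod_cast h3

end Dimension

/-! ### Immersions and maps with vanishing derivative -/

section Immersions

variable {n r : ℕ} {M : Type*} [TopologicalSpace M] [ChartedSpace (Euc n) M]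
  {N : Type*} [TopologicalSpace N] [ChartedSpace (Euc r) N]

/-- Normal form of an immersion near a point. -/
theorem Manifold.IsImmersion.exists_normalForm {f : N → M}
    (hf : IsImmersion (Mdl r) (Mdl n) ∞ f) (y : N) :
    ∃ (k : ℕ) (L : Euc n ≃L[ℝ] Euc k × Euc r) (χ : OpenPartialHomeomorph N (Euc r))
      (φ : OpenPartialHomeomorph M (Euc n)),
      χ ∈ IsManifold.maximalAtlas (Mdl r) ∞ N ∧ φ ∈ IsManifold.maximalAtlas (Mdl n) ∞ M ∧
      y ∈ χ.source ∧ (∀ z ∈ χ.source, f z ∈ φ.source) ∧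
      ∀ z ∈ χ.source, L (φ (f z)) = (0, χ z) := by
  obtain ⟨F, i1, i2, h⟩ := hf
  have hy := h y
  have : FiniteDimensional ℝ F :=
    FiniteDimensional.of_injective
      (hy.equiv.toLinearMap.comp (LinearMap.inr ℝ (Euc r) F)) fun a b hab ↦ by
        simpa using hab
  let e : F ≃L[ℝ] Euc (finrank ℝ F) := ContinuousLinearEquiv.ofFinrankEq (by simp)
  refine ⟨finrank ℝ F, (hy.equiv.symm.trans (ContinuousLinearEquiv.prodComm ℝ _ _)).trans
    (e.prodCongr (ContinuousLinearEquiv.refl ℝ _)),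
    hy.domChart, hy.codChart, hy.domChart_mem_maximalAtlas, hy.codChart_mem_maximalAtlas,
    hy.mem_domChart_source, fun z hz ↦ hy.source_subset_preimage_source hz, fun z hz ↦ ?_⟩
  have hz' : hy.domChart z ∈ (hy.domChart.extend (Mdl r)).target := by
    rw [OpenPartialHomeomorph.extend_target]; simpa using hy.domChart.map_source hz
  have := hy.writtenInCharts hz'
  simp only [Function.comp_apply, mfld_simps, hy.domChart.left_inv hz] at this
  rw [ContinuousLinearEquiv.trans_apply, ContinuousLinearEquiv.trans_apply, this]
  simp

theorem Manifold.IsImmersion.contMDiff' {f : N → M}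
    (hf : IsImmersion (Mdl r) (Mdl n) ∞ f) : ContMDiff (Mdl r) (Mdl n) ∞ f := by
  obtain ⟨F, i1, i2, h⟩ := hf
  exact fun x ↦ (h x).contMDiffAt

variable [IsManifold (Mdl n) ∞ M] [IsManifold (Mdl r) ∞ N]

omit [IsManifold (Mdl n) ∞ M] in
/-- A map which is a slice in charts has the same tangent spaces as the slice. -/
theorem range_mfderiv_eq_of_normalForm {f : N → M} {k : ℕ} {L : Euc n ≃L[ℝ] Euc k × Euc r}
    {χ : OpenPartialHomeomorph N (Euc r)} {φ : OpenPartialHomeomorph M (Euc n)}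
    (hχ : χ ∈ IsManifold.maximalAtlas (Mdl r) ∞ N) (hφ : φ ∈ IsManifold.maximalAtlas (Mdl n) ∞ M)
    {c : Euc k} (hs : ∀ z ∈ χ.source, f z ∈ φ.source)
    (hf : ∀ z ∈ χ.source, L (φ (f z)) = (c, χ z)) {z : N} (hz : z ∈ χ.source) :
    χ z ∈ chartSliceSource L φ c ∧ chartSlice L φ c (χ z) = f z ∧
    (mfderiv (Mdl r) (Mdl n) f z).range =
      (mfderiv (Mdl r) (Mdl n) (chartSlice L φ c) (χ z)).range := by
  have hχd := OpenPartialHomeomorph.mdifferentiable_of_mem_maximalAtlas hχ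
  have hmem : ∀ z ∈ χ.source, χ z ∈ chartSliceSource L φ c := fun z hz ↦ by
    have := mem_chartSliceSource (L := L) (hs z hz)
    rwa [hf z hz] at this
  have heq : ∀ z ∈ χ.source, chartSlice L φ c (χ z) = f z := fun z hz ↦ by
    have := chartSlice_apply (L := L) (hs z hz)
    rwa [hf z hz] at this
  refine ⟨hmem z hz, heq z hz, ?_⟩
  have h1 := (hχd.mdifferentiableAt hz).hasMFDerivAt
  have h2 : HasMFDerivAt (Mdl r) (Mdl n) (chartSlice L φ c) (χ z) _ :=
    (((contMDiffOn_chartSlice hφ c).contMDiffAt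
      ((isOpen_chartSliceSource c).mem_nhds (hmem z hz))).mdifferentiableAt (by simp)).hasMFDerivAt
  have h3 : HasMFDerivAt (Mdl r) (Mdl n) f z _ := (h2.comp z h1).congr_of_eventuallyEq <| by
    filter_upwards [χ.open_source.mem_nhds hz] with y hy using (heq y hy).symm
  rw [h3.mfderiv]
  let A : Euc r →L[ℝ] Euc r := mfderiv (Mdl r) (Mdl r) χ z
  let B : Euc r →L[ℝ] Euc n := mfderiv (Mdl r) (Mdl n) (chartSlice L φ c) (χ z)
  have hA : A.toLinearMap.range = ⊤ := LinearMap.range_eq_top.2 (hχd.mfderiv_surjective hz)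
  change (B.toLinearMap.comp A.toLinearMap).range = B.toLinearMap.range
  rw [LinearMap.range_comp, hA, Submodule.map_top]

/-- In the normal form, the second component of `φ ∘ f` is the chart `χ`, whose derivative is
injective. -/
theorem Manifold.IsImmersion.mfderiv_injective {f : N → M}
    (hf : IsImmersion (Mdl r) (Mdl n) ∞ f) (y : N) :
    Function.Injective (mfderiv (Mdl r) (Mdl n) f y) := by
  obtain ⟨k, L, χ, φ, hχ, hφ, hy, hs, hL⟩ := hf.exists_normalForm y
  have hχd := OpenPartialHomeomorph.mdifferentiable_of_mem_maximalAtlas hχ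
  have hφd := OpenPartialHomeomorph.mdifferentiable_of_mem_maximalAtlas hφ
  have h1 : HasMFDerivAt (Mdl r) (Mdl n) f y _ :=
    (hf.contMDiff'.contMDiffAt.mdifferentiableAt (by simp)).hasMFDerivAt
  have h2 := (hφd.mdifferentiableAt (hs y hy)).hasMFDerivAt.comp y h1
  let P : Euc n →L[ℝ] Euc r := (ContinuousLinearMap.snd ℝ _ _).comp L.toContinuousLinearMap
  have h3 := (P.hasFDerivAt (x := φ (f y))).hasMFDerivAt.comp y h2
  have h4 : HasMFDerivAt (Mdl r) (Mdl r) χ y _ := h3.congr_of_eventuallyEq <| by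
    filter_upwards [χ.open_source.mem_nhds hy] with z hz
    exact (congrArg Prod.snd (hL z hz)).symm
  have h5 := hχd.mfderiv_injective hy
  rw [h4.mfderiv] at h5
  intro a b hab
  apply h5
  change P (mfderiv (Mdl n) (Mdl n) φ (f y) (mfderiv (Mdl r) (Mdl n) f y a)) =
    P (mfderiv (Mdl n) (Mdl n) φ (f y) (mfderiv (Mdl r) (Mdl n) f y b))
  rw [hab]

/-- A smooth map with vanishing derivative is locally constant. -/
theorem isLocallyConstant_of_mfderiv_eq_zero {h : N → M} (hh : ContMDiff (Mdl r) (Mdl n) ∞ h)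
    (h0 : ∀ y, mfderiv (Mdl r) (Mdl n) h y = 0) : IsLocallyConstant h := by
  rw [IsLocallyConstant.iff_eventually_eq]
  intro w
  let χ := chartAt (Euc r) w
  let φ := chartAt (Euc n) (h w)
  have hχ : χ ∈ IsManifold.maximalAtlas (Mdl r) ∞ N := IsManifold.chart_mem_maximalAtlas w
  have hφ : φ ∈ IsManifold.maximalAtlas (Mdl n) ∞ M := IsManifold.chart_mem_maximalAtlas _
  have hχd := OpenPartialHomeomorph.mdifferentiable_of_mem_maximalAtlas hχ
  have hφd := OpenPartialHomeomorph.mdifferentiable_of_mem_maximalAtlas hφ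
  have hwχ : w ∈ χ.source := mem_chart_source _ w
  have hwφ : h w ∈ φ.source := mem_chart_source _ _
  let T : Set (Euc r) := χ.target ∩ χ.symm ⁻¹' (h ⁻¹' φ.source)
  have hT : IsOpen T := χ.isOpen_inter_preimage_symm (φ.open_source.preimage hh.continuous)
  have hwT : χ w ∈ T := ⟨χ.map_source hwχ, by
    simpa only [mem_preimage, χ.left_inv hwχ] using hwφ⟩
  obtain ⟨ε, hε, hball⟩ := Metric.isOpen_iff.1 hT _ hwT
  let g : Euc r → Euc n := fun z ↦ φ (h (χ.symm z))
  have hder : ∀ z ∈ T, HasFDerivAt g (0 : Euc r →L[ℝ] Euc n) z := by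
    intro z hz
    have h1 := (hχd.mdifferentiableAt_symm hz.1).hasMFDerivAt
    have h2 : HasMFDerivAt (Mdl r) (Mdl n) h (χ.symm z) 0 := by
      have := (hh.contMDiffAt (x := χ.symm z)).mdifferentiableAt (by simp) |>.hasMFDerivAt
      rwa [h0] at this
    have h3 := (hφd.mdifferentiableAt hz.2).hasMFDerivAt
    have h4 := (h3.comp z (h2.comp z h1)).hasFDerivAt
    refine h4.congr_fderiv ?_
    ext1 v
    exact map_zero (mfderiv (Mdl n) (Mdl n) φ (h (χ.symm z)))
  have hconst : ∀ z ∈ Metric.ball (χ w) ε, g z = g (χ w) := fun z hz ↦ by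
    refine (convex_ball (χ w) ε).is_const_of_fderivWithin_eq_zero (𝕜 := ℝ)
      (fun t ht ↦ (hder t (hball ht)).differentiableAt.differentiableWithinAt) ?_ hz
      (Metric.mem_ball_self hε)
    intro t ht
    rw [fderivWithin_of_isOpen Metric.isOpen_ball ht]
    exact (hder t (hball ht)).fderiv
  filter_upwards [χ.open_source.mem_nhds hwχ, χ.continuousAt hwχ (Metric.ball_mem_nhds _ hε)]
    with y hy1 hy2
  have h1 := hconst _ hy2
  have h2 := (hball hy2).2
  simp only [mem_preimage, χ.left_inv hy1] at h2
  simp only [g, χ.left_inv hy1, χ.left_inv hwχ] at h1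
  exact φ.injOn h2 hwφ h1

end Immersions

/-! ### Basic properties of integral manifolds -/

namespace TangentDistribution

variable {n : ℕ} {M : Type u} [TopologicalSpace M] [ChartedSpace (Euc n) M]
  [IsManifold (Mdl n) ∞ M] {Δ : TangentDistribution n M}

/-- A connected open piece of a chart slice tangent to `Δ` is a connected integral manifold. -/
theorem exists_isIntegralManifold_of_chartSlice {k d : ℕ} {L : Euc n ≃L[ℝ] Euc k × Euc d}
    {φ : OpenPartialHomeomorph M (Euc n)} (hφ : φ ∈ IsManifold.maximalAtlas (Mdl n) ∞ M)
    {c : Euc k} {B : Set (Euc d)} (hB : IsOpen B) (hBc : IsConnected B)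
    (hsub : B ⊆ chartSliceSource L φ c)
    (hΔ : ∀ t ∈ B, (mfderiv (Mdl d) (Mdl n) (chartSlice L φ c) t).range =
      Δ (chartSlice L φ c t)) :
    ∃ (N : Type u) (_ : TopologicalSpace N) (_ : ChartedSpace (Euc d) N) (f : N → M),
      Δ.IsIntegralManifold d N f ∧ ConnectedSpace N ∧ range f = chartSlice L φ c '' B := by
  -- Integral manifolds live in the universe of `M`, hence the lift.
  let e : ULift.{u} B → Euc d := fun b ↦ b.down.1
  have he : Topology.IsOpenEmbedding e := hB.isOpenEmbedding_subtypeVal.comp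
    Homeomorph.ulift.isOpenEmbedding
  have : Nonempty (ULift.{u} B) := ⟨⟨_, hBc.nonempty.some_mem⟩⟩
  let _ : ChartedSpace (Euc d) (ULift.{u} B) := he.singletonChartedSpace
  have hman : IsManifold (Mdl d) ∞ (ULift.{u} B) := he.isManifold_singleton
  let χ := he.toOpenPartialHomeomorph e
  have hχ : χ ∈ IsManifold.maximalAtlas (Mdl d) ∞ (ULift.{u} B) :=
    IsManifold.subset_maximalAtlas (mem_singleton _)
  have hχe : ∀ y, χ y = e y := fun y ↦ rfl
  let f : ULift.{u} B → M := fun b ↦ chartSlice L φ c (e b)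
  have hnf : ∀ z ∈ χ.source, L (φ (f z)) = (c, χ z) := fun z _ ↦
    apply_chartSlice (hsub z.down.2)
  have hs : ∀ z ∈ χ.source, f z ∈ φ.source := fun z _ ↦ chartSlice_mem_source (hsub z.down.2)
  refine ⟨ULift.{u} B, inferInstance, inferInstance, f, ⟨?_, ?_, hman, ?_, ?_, ?_⟩, ?_, ?_⟩
  · exact he.isEmbedding.t2Space
  · exact he.isEmbedding.secondCountableTopology
  · intro a b hab
    have h1 := hnf a trivial
    have h2 := hnf b trivial
    rw [hab, h2] at h1
    exact he.injective (congrArg Prod.snd h1).symm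
  · let E : (Euc d × Euc k) ≃L[ℝ] Euc n := (ContinuousLinearEquiv.prodComm ℝ _ _).trans L.symm
    -- The normal form of an immersion has zero complementary coordinate, so the chart is translated
    -- by the height `c` of the slice.
    let τ : Homeomorph (Euc n) (Euc n) := Homeomorph.addRight (-L.symm (c, 0))
    let ψ : OpenPartialHomeomorph M (Euc n) := φ.trans τ.toOpenPartialHomeomorph
    have hψs : ∀ x, x ∈ ψ.source ↔ x ∈ φ.source := fun x ↦ by simp [ψ]
    have hψ : ψ ∈ IsManifold.maximalAtlas (Mdl n) ∞ M := by
      rw [IsManifold.mem_maximalAtlas_iff_contMDiffOn]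
      constructor
      · refine ((contDiff_id.add contDiff_const : ContDiff ℝ ∞ fun z : Euc n ↦
          z + -L.symm (c, 0)).contMDiff).comp_contMDiffOn
          ((contMDiffOn_of_mem_maximalAtlas hφ).mono fun x hx ↦ (hψs x).1 hx)
      · refine (contMDiffOn_symm_of_mem_maximalAtlas hφ).comp (t := φ.target)
          (f := τ.symm) ?_ ?_
        · exact (contDiff_id.add contDiff_const : ContDiff ℝ ∞ fun z : Euc n ↦
            z + -(-L.symm (c, 0))).contMDiff.contMDiffOn
        · intro z hz
          simpa [ψ] using hz
    refine IsImmersionOfComplement.isImmersion (F := Euc k) fun y ↦ ?_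
    refine IsImmersionAtOfComplement.mk_of_charts E χ ψ trivial ((hψs _).2 (hs y trivial)) hχ hψ
      (fun z _ ↦ (hψs _).2 (hs z trivial)) ?_
    intro z hz
    have hz' : z ∈ χ.target := by simpa using hz
    have h1 := hnf _ (χ.map_target hz')
    rw [χ.right_inv hz'] at h1
    have h2 : φ (f (χ.symm z)) = L.symm (c, z) := by rw [← h1, L.symm_apply_apply]
    have h3 : L.symm (c, z) + -L.symm (c, 0) = L.symm (0, z) := by
      rw [← sub_eq_add_neg, ← map_sub]; simp
    change φ (f (χ.symm z)) + -L.symm (c, 0) = L.symm (0, z)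
    rw [h2, h3]
  · intro y
    have h := range_mfderiv_eq_of_normalForm hχ hφ hs hnf (z := y) trivial
    rw [h.2.2]
    exact hΔ _ y.down.2
  · have : ConnectedSpace B := isConnected_iff_connectedSpace.1 hBc
    exact Homeomorph.ulift.symm.surjective.connectedSpace Homeomorph.ulift.symm.continuous
  · ext x
    constructor
    · rintro ⟨y, rfl⟩
      exact ⟨_, y.down.2, rfl⟩
    · rintro ⟨t, ht, rfl⟩
      exact ⟨⟨⟨t, ht⟩⟩, rfl⟩

/-- Nearby points of an integral manifold lie on a common connected integral manifold. -/
theorem IsIntegralManifold.eventually_onCommon {r : ℕ} {N : Type u} [TopologicalSpace N]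
    [ChartedSpace (Euc r) N] {f : N → M} (hf : Δ.IsIntegralManifold r N f) (y : N) :
    ∀ᶠ z in 𝓝 y, Δ.OnCommonIntegralManifold (f y) (f z) := by
  have := hf.isManifold
  obtain ⟨k, L, χ, φ, hχ, hφ, hy, hs, hL⟩ := hf.isImmersion.exists_normalForm y
  have hnf := fun z (hz : z ∈ χ.source) ↦ range_mfderiv_eq_of_normalForm hχ hφ hs hL hz
  -- `N` need not be connected, but a ball in the chart is.
  obtain ⟨ε, hε, hball⟩ := Metric.isOpen_iff.1 χ.open_target _ (χ.map_source hy)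
  have hback : ∀ t ∈ χ.target, t ∈ chartSliceSource L φ 0 ∧
      (mfderiv (Mdl r) (Mdl n) (chartSlice L φ 0) t).range = Δ (chartSlice L φ 0 t) := by
    intro t ht
    obtain ⟨h1, h2, h3⟩ := hnf _ (χ.map_target ht)
    rw [χ.right_inv ht] at h1 h2 h3
    exact ⟨h1, by rw [← h3, h2, hf.tangent]⟩
  obtain ⟨N', i1, i2, f', hf', hN', hrange⟩ := exists_isIntegralManifold_of_chartSlice (Δ := Δ)
    hφ Metric.isOpen_ball (Metric.isConnected_ball hε)
    (fun t ht ↦ (hback t (hball ht)).1) (fun t ht ↦ (hback t (hball ht)).2)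
  have hmem : ∀ z ∈ χ.source, χ z ∈ Metric.ball (χ y) ε → f z ∈ range f' := by
    intro z hz hzb
    rw [hrange]
    exact ⟨_, hzb, (hnf z hz).2.1⟩
  filter_upwards [χ.open_source.mem_nhds hy, χ.continuousAt hy (Metric.ball_mem_nhds _ hε)]
    with z hz1 hz2
  exact ⟨r, N', i1, i2, f', hf', hN', hmem y hy (Metric.mem_ball_self hε), hmem z hz1 hz2⟩

/-- Consequently integral manifolds through a common point have equal dimensions, even where the
rank of `Δ` jumps. -/
theorem IsIntegralManifold.finrank_eq {r : ℕ} {N : Type u} [TopologicalSpace N]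
    [ChartedSpace (Euc r) N] {f : N → M} (hf : Δ.IsIntegralManifold r N f) (y : N) :
    finrank ℝ (Δ (f y)) = r := by
  have := hf.isManifold
  rw [← hf.tangent y]
  let A : Euc r →L[ℝ] Euc n := mfderiv (Mdl r) (Mdl n) f y
  have hA : Function.Injective A.toLinearMap := hf.isImmersion.mfderiv_injective y
  have h := LinearMap.finrank_range_of_inj hA
  rw [finrank_euclideanSpace, Fintype.card_fin] at h
  exact h

omit [IsManifold (Mdl n) ∞ M] in
/-- A map whose derivative kills `Δ` is constant on connected integral manifolds. -/
theorem IsIntegralManifold.apply_eq {r : ℕ} {N : Type u} [TopologicalSpace N]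
    [ChartedSpace (Euc r) N] {f : N → M} (hf : Δ.IsIntegralManifold r N f)
    [ConnectedSpace N] {m : ℕ} {P : Type*} [TopologicalSpace P] [ChartedSpace (Euc m) P]
    [IsManifold (Mdl m) ∞ P] {g : M → P} (hg : ContMDiff (Mdl n) (Mdl m) ∞ g)
    (h0 : ∀ x, ∀ v ∈ Δ x, mfderiv (Mdl n) (Mdl m) g x v = 0) (y z : N) :
    g (f y) = g (f z) := by
  have := hf.isManifold
  refine (isLocallyConstant_of_mfderiv_eq_zero (h := g ∘ f) (hg.comp hf.isImmersion.contMDiff')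
    fun w ↦ ?_).apply_eq_of_preconnectedSpace y z
  rw [mfderiv_comp w (hg.contMDiffAt.mdifferentiableAt (by simp))
    (hf.isImmersion.contMDiff'.contMDiffAt.mdifferentiableAt (by simp))]
  ext1 v
  refine h0 _ _ ?_
  rw [← hf.tangent w]
  exact ⟨v, rfl⟩

/-- The projection to the leaf space kills `Δ`, when it is smooth. -/
theorem le_ker_mfderiv_leafProj {m : ℕ} [ChartedSpace (Euc m) Δ.LeafSpace]
    (hint : Δ.IsIntegrable) (hq : ContMDiff (Mdl n) (Mdl m) ∞ Δ.leafProj) (x : M) :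
    Δ x ≤ (mfderiv (Mdl n) (Mdl m) Δ.leafProj x).ker := by
  obtain ⟨r, N, i1, i2, f, hf, y, rfl⟩ := hint x
  intro v hv
  rw [← hf.tangent y] at hv
  obtain ⟨w, rfl⟩ := hv
  have h1 : HasMFDerivAt (Mdl r) (Mdl n) f y _ :=
    (hf.isImmersion.contMDiff'.contMDiffAt.mdifferentiableAt (by simp)).hasMFDerivAt
  have h2 := (hq.contMDiffAt.mdifferentiableAt (x := f y) (by simp)).hasMFDerivAt.comp y h1
  -- The projection is locally constant along an integral manifold.
  have h3 : HasMFDerivAt (Mdl r) (Mdl m) (Δ.leafProj ∘ f) y 0 :=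
    (hasMFDerivAt_const (Δ.leafProj (f y)) y).congr_of_eventuallyEq <| by
      filter_upwards [hf.eventually_onCommon y] with z hz
      exact (Quotient.sound (Relation.EqvGen.rel _ _ hz)).symm
  exact congrArg (fun A ↦ A w) (hasMFDerivAt_unique h2 h3)

end TangentDistribution

/-! ### Local uniqueness of integral manifolds without constant rank -/

/-- A function on a ball which vanishes at the centre and whose derivative is bounded by a multiple
of the function vanishes identically. -/
theorem eq_zero_on_ball_of_norm_fderiv_le {E F : Type*} [NormedAddCommGroup E] [NormedSpace ℝ E]
    [NormedAddCommGroup F] [NormedSpace ℝ F] {h : E → F} {h' : E → E →L[ℝ] F} {w : E} {ε K : ℝ}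
    (hh : ∀ t ∈ Metric.ball w ε, HasFDerivAt h (h' t) t) (hw : h w = 0)
    (hK : ∀ t ∈ Metric.ball w ε, ∀ v, ‖h' t v‖ ≤ K * ‖h t‖ * ‖v‖) {t : E}
    (ht : t ∈ Metric.ball w ε) : h t = 0 := by
  -- On the segment from `w` to `t`, the bound becomes a linear differential inequality in one real
  -- variable (Gronwall).
  let γ : ℝ → E := fun s ↦ w + s • (t - w)
  have hγ : ∀ s ∈ Icc (0 : ℝ) 1, γ s ∈ Metric.ball w ε := by
    intro s hs
    rw [Metric.mem_ball, dist_eq_norm] at ht ⊢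
    have : γ s - w = s • (t - w) := by simp [γ]
    rw [this, norm_smul, Real.norm_eq_abs, abs_of_nonneg hs.1]
    exact (mul_le_of_le_one_left (norm_nonneg _) hs.2).trans_lt ht
  have hd : ∀ s ∈ Icc (0 : ℝ) 1, HasDerivAt (fun s ↦ h (γ s)) (h' (γ s) (t - w)) s := by
    intro s hs
    have h1 : HasDerivAt γ (t - w) s := by
      have := ((hasDerivAt_id s).smul_const (t - w)).const_add w
      rwa [one_smul] at this
    exact (hh _ (hγ s hs)).comp_hasDerivAt s h1
  have key := eq_zero_of_abs_deriv_le_mul_abs_self_of_eq_zero_right (a := 0) (b := 1)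
    (K := K * ‖t - w‖) (f := fun s ↦ h (γ s))
    (fun s hs ↦ (hd s hs).continuousAt.continuousWithinAt)
    (fun s hs ↦ (hd s (Ico_subset_Icc_self hs)).hasDerivWithinAt) (by simpa [γ] using hw)
    (fun s hs ↦ by
      have := hK _ (hγ s (Ico_subset_Icc_self hs)) (t - w)
      nlinarith [this]) 1 (by simp)
  simpa [γ] using key

/-- A frame of vector fields which is tangent to the slice `{0} × E₂` is nearly tangent to it
near the slice. -/
theorem exists_norm_fst_le_of_tangent {E₁ E₂ : Type*} [NormedAddCommGroup E₁] [NormedSpace ℝ E₁]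
    [NormedAddCommGroup E₂] [NormedSpace ℝ E₂] {A : E₁ × E₂ → E₂ →L[ℝ] E₁ × E₂} {a : E₂}
    (hA : ContDiffAt ℝ 1 A (0, a)) (hid : ∀ ξ, (A (0, a) ξ).2 = ξ)
    (h0 : ∀ᶠ p in 𝓝 ((0 : E₁), a), p.1 = 0 → ∀ ξ, (A p ξ).1 = 0) :
    ∃ ε > 0, ∃ K : ℝ, 0 ≤ K ∧ ∀ p ∈ Metric.ball ((0 : E₁), a) ε, ∀ ξ,
      ‖ξ‖ ≤ 2 * ‖(A p ξ).2‖ ∧ ‖(A p ξ).1‖ ≤ K * ‖p.1‖ * ‖(A p ξ).2‖ := by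
  obtain ⟨K, T, hT, hlip⟩ := hA.exists_lipschitzOnWith
  have hclose : ∀ᶠ p in 𝓝 ((0 : E₁), a), ‖A p - A (0, a)‖ ≤ 1 / 2 := by
    have h1 : Filter.Tendsto (fun p ↦ ‖A p - A (0, a)‖) (𝓝 (0, a)) (𝓝 0) := by
      have := (hA.continuousAt.sub (continuousAt_const (y := A (0, a)))).norm
      rw [ContinuousAt] at this
      simpa using this
    filter_upwards [h1 (Iic_mem_nhds (by norm_num : (0 : ℝ) < 1 / 2))] with p hp using hp
  obtain ⟨ε, hε, hball⟩ := Metric.eventually_nhds_iff_ball.1 ((h0.and hclose).and hT)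
  -- `K` is the Lipschitz constant of `A`, which compares `p` with its foot `(0, p.2)` on the slice;
  -- the factor `2` comes from `A p` being within `1/2` of `A (0, a)`, whose second component is the
  -- identity.
  refine ⟨ε, hε, K * 2, by positivity, fun p hp ξ ↦ ?_⟩
  obtain ⟨⟨-, hp2⟩, hpT⟩ := hball p hp
  have hp' : ((0 : E₁), p.2) ∈ Metric.ball ((0 : E₁), a) ε := by
    rw [Metric.mem_ball, Prod.dist_eq] at hp ⊢
    refine lt_of_le_of_lt ?_ hp
    simp
  obtain ⟨⟨hp'1, -⟩, hp'T⟩ := hball _ hp'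
  have hξ : ‖ξ‖ ≤ 2 * ‖(A p ξ).2‖ := by
    have h1 : ξ = (A p ξ).2 - ((A p - A (0, a)) ξ).2 := by
      rw [_root_.sub_apply, Prod.snd_sub, hid]; abel
    have h2 : ‖((A p - A (0, a)) ξ).2‖ ≤ 1 / 2 * ‖ξ‖ :=
      (norm_snd_le _).trans (((A p - A (0, a)).le_opNorm ξ).trans (by gcongr))
    have h3 : ‖ξ‖ ≤ ‖(A p ξ).2‖ + ‖((A p - A (0, a)) ξ).2‖ := by
      conv_lhs => rw [h1]
      exact norm_sub_le _ _
    linarith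
  refine ⟨hξ, ?_⟩
  have h1 : (A p ξ).1 = ((A p - A (0, p.2)) ξ).1 := by
    rw [_root_.sub_apply, Prod.fst_sub, hp'1 rfl ξ, sub_zero]
  have h2 : ‖A p - A (0, p.2)‖ ≤ K * ‖p.1‖ := by
    have := hlip.dist_le_mul p hpT _ hp'T
    rw [dist_eq_norm, dist_eq_norm] at this
    refine this.trans_eq ?_
    congr 1
    rw [Prod.norm_def]; simp
  calc ‖(A p ξ).1‖ ≤ ‖(A p - A (0, p.2)) ξ‖ := by rw [h1]; exact norm_fst_le _
    _ ≤ K * ‖p.1‖ * ‖ξ‖ := ((A p - A (0, p.2)).le_opNorm ξ).trans (by gcongr)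
    _ ≤ K * ‖p.1‖ * (2 * ‖(A p ξ).2‖) := by gcongr
    _ = K * 2 * ‖p.1‖ * ‖(A p ξ).2‖ := by ring

/-- A smooth vector field is smooth in charts. -/
theorem contMDiffOn_mfderiv_chart_apply {n : ℕ} {M : Type*} [TopologicalSpace M]
    [ChartedSpace (Euc n) M] [IsManifold (Mdl n) ∞ M] {φ : OpenPartialHomeomorph M (Euc n)}
    (hφ : φ ∈ IsManifold.maximalAtlas (Mdl n) ∞ M) {U : Set M}
    {X : (y : M) → TangentSpace (Mdl n) y}
    (hX : ContMDiffOn (Mdl n) (Mdl n).tangent ∞ (fun y ↦ (⟨y, X y⟩ : TangentBundle (Mdl n) M)) U) :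
    ContMDiffOn (Mdl n) (Mdl n) ∞
      (fun y ↦ (mfderiv (Mdl n) (Mdl n) φ y (X y) : Euc n)) (U ∩ φ.source) := by
  have : IsManifold (Mdl n) 1 M := IsManifold.of_le (n := ∞) (by simp)
  have hφd := OpenPartialHomeomorph.mdifferentiable_of_mem_maximalAtlas hφ
  have h1 := (contMDiffOn_of_mem_maximalAtlas hφ).contMDiffOn_tangentMapWithin (m := ∞)
    (by simp) φ.open_source.uniqueMDiffOn
  have h2 := h1.comp (hX.mono (inter_subset_left (t := φ.source))) (fun y hy ↦ hy.2)
  have h3 := (contMDiff_snd_tangentBundle_modelSpace (n := ∞) (Euc n) (Mdl n)).comp_contMDiffOn h2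
  refine h3.congr fun y hy ↦ ?_
  have h4 := tangentMapWithin_eq_tangentMap (p := (⟨y, X y⟩ : TangentBundle (Mdl n) M))
    (φ.open_source.uniqueMDiffOn y hy.2) (hφd.mdifferentiableAt hy.2)
  exact (congrArg (fun q : TangentBundle (Mdl n) (Euc n) ↦ q.2) h4).symm

namespace TangentDistribution

variable {n : ℕ} {M : Type u} [TopologicalSpace M] [ChartedSpace (Euc n) M]
  [IsManifold (Mdl n) ∞ M] {Δ : TangentDistribution n M}

/-- The set `A` is contained in an integral manifold of `Δ`. -/
def InIntegralManifold (Δ : TangentDistribution n M) (A : Set M) : Prop :=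
  ∃ (r : ℕ) (N : Type u) (_ : TopologicalSpace N) (_ : ChartedSpace (Euc r) N) (f : N → M),
    Δ.IsIntegralManifold r N f ∧ A ⊆ range f

/-- If the derivative bound `|pr₁ v| ≤ K |pr₁ z| |pr₂ v|` holds for the vectors `v ∈ Δ z` of an
integral manifold in a chart, then its intersection with the slice `pr₁ = 0` is open. -/
theorem IsIntegralManifold.isOpen_preimage_slice {r k d : ℕ} {N : Type u} [TopologicalSpace N]
    [ChartedSpace (Euc r) N] {f : N → M} (hf : Δ.IsIntegralManifold r N f)
    {φ : OpenPartialHomeomorph M (Euc n)} (hφ : φ ∈ IsManifold.maximalAtlas (Mdl n) ∞ M)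
    {L : Euc n ≃L[ℝ] Euc k × Euc d} {U : Set M} (hU : IsOpen U) (hUφ : U ⊆ φ.source) {K : ℝ}
    (hK0 : 0 ≤ K)
    (hK : ∀ z : N, f z ∈ U → ∀ v ∈ Δ (f z),
      ‖(L (mfderiv (Mdl n) (Mdl n) φ (f z) v)).1‖ ≤
        K * ‖(L (φ (f z))).1‖ * ‖(L (mfderiv (Mdl n) (Mdl n) φ (f z) v)).2‖) :
    IsOpen (f ⁻¹' (U ∩ {z | (L (φ z)).1 = 0})) := by
  have := hf.isManifold
  have hfs := hf.isImmersion.contMDiff'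
  rw [isOpen_iff_mem_nhds]
  rintro w ⟨hwU, hw0⟩
  let χ := chartAt (Euc r) w
  have hχ : χ ∈ IsManifold.maximalAtlas (Mdl r) ∞ N := IsManifold.chart_mem_maximalAtlas w
  have hχd := OpenPartialHomeomorph.mdifferentiable_of_mem_maximalAtlas hχ
  have hφd := OpenPartialHomeomorph.mdifferentiable_of_mem_maximalAtlas hφ
  have hwχ : w ∈ χ.source := mem_chart_source _ w
  let T : Set (Euc r) := χ.target ∩ χ.symm ⁻¹' (f ⁻¹' U)
  have hT : IsOpen T := χ.isOpen_inter_preimage_symm (hU.preimage hfs.continuous)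
  let g : Euc r → Euc k × Euc d := fun t ↦ L (φ (f (χ.symm t)))
  have hg : ContDiffOn ℝ ∞ g T := by
    refine L.contDiff.comp_contDiffOn ?_
    rw [← contMDiffOn_iff_contDiffOn]
    refine (contMDiffOn_of_mem_maximalAtlas hφ).comp (t := φ.source) ?_ (fun z hz ↦ hUφ hz.2)
    exact hfs.comp_contMDiffOn ((contMDiffOn_symm_of_mem_maximalAtlas hχ).mono fun z hz ↦ hz.1)
  have hwT : χ w ∈ T := ⟨χ.map_source hwχ, by
    simpa only [mem_preimage, χ.left_inv hwχ] using hwU⟩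
  have hder : ∀ t ∈ T, HasFDerivAt g (fderiv ℝ g t) t := fun t ht ↦
    ((hg.contDiffAt (hT.mem_nhds ht)).differentiableAt (by simp)).hasFDerivAt
  have hbound : ∀ t ∈ T, ∀ v, ‖(fderiv ℝ g t v).1‖ ≤ K * ‖(g t).1‖ * ‖(fderiv ℝ g t v).2‖ := by
    intro t ht v
    have h1 := (hχd.mdifferentiableAt_symm ht.1).hasMFDerivAt
    have h2 : HasMFDerivAt (Mdl r) (Mdl n) f (χ.symm t) _ :=
      (hfs.contMDiffAt.mdifferentiableAt (by simp)).hasMFDerivAt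
    have h3 := (hφd.mdifferentiableAt (hUφ ht.2)).hasMFDerivAt
    have h4 := L.toContinuousLinearMap.hasFDerivAt.comp t (h3.comp t (h2.comp t h1)).hasFDerivAt
    rw [(hder t ht).unique h4]
    refine hK (χ.symm t) ht.2 (mfderiv (Mdl r) (Mdl n) f (χ.symm t)
      (mfderiv (Mdl r) (Mdl r) χ.symm t v)) ?_
    rw [← hf.tangent]
    exact ⟨_, rfl⟩
  have hcont : ContinuousAt (fun t ↦ fderiv ℝ g t) (χ w) :=
    (hg.continuousOn_fderiv_of_isOpen hT (by simp)).continuousAt (hT.mem_nhds hwT)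
  -- A local bound on the derivative bounds the factor `pr₂` and turns the estimate into a linear
  -- one for the first component alone.
  obtain ⟨C, hC⟩ : ∃ C, ∀ᶠ t in 𝓝 (χ w), ‖fderiv ℝ g t‖ ≤ C :=
    ⟨‖fderiv ℝ g (χ w)‖ + 1, (hcont.norm.eventually (gt_mem_nhds (lt_add_one _))).mono
      fun t ht ↦ le_of_lt ht⟩
  obtain ⟨ε, hε, hball⟩ := Metric.eventually_nhds_iff_ball.1 (hC.and (hT.mem_nhds hwT))
  have hzero : ∀ t ∈ Metric.ball (χ w) ε, (g t).1 = 0 := by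
    intro t ht
    refine eq_zero_on_ball_of_norm_fderiv_le (h := fun t ↦ (g t).1) (K := K * C)
      (h' := fun t ↦ (ContinuousLinearMap.fst ℝ _ _).comp (fderiv ℝ g t))
      (fun t ht ↦ (hder t (hball t ht).2).fst) ?_ ?_ ht
    · simpa only [g, χ.left_inv hwχ] using (show (L (φ (f w))).1 = 0 from hw0)
    · intro t ht v
      refine (hbound t (hball t ht).2 v).trans ?_
      have h1 : ‖(fderiv ℝ g t v).2‖ ≤ C * ‖v‖ :=
        (norm_snd_le _).trans (((fderiv ℝ g t).le_opNorm v).trans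
          (mul_le_mul_of_nonneg_right (hball t ht).1 (norm_nonneg _)))
      calc K * ‖(g t).1‖ * ‖(fderiv ℝ g t v).2‖ ≤ K * ‖(g t).1‖ * (C * ‖v‖) := by gcongr
        _ = K * C * ‖(g t).1‖ * ‖v‖ := by ring
  filter_upwards [χ.open_source.mem_nhds hwχ, χ.continuousAt hwχ (Metric.ball_mem_nhds _ hε)]
    with y hy1 hy2
  have h1 := hzero _ hy2
  have h2 := (hball _ hy2).2.2
  simp only [g, mem_preimage, χ.left_inv hy1] at h1 h2
  exact ⟨h2, h1⟩

/-- Every point has a neighbourhood `U` in which the local leaf `P` contains all connected pieces of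
integral manifolds that meet it. -/
theorem exists_localLeaf (hsmooth : Δ.IsSmooth) (hint : Δ.IsIntegrable) (x : M) :
    ∃ U P : Set M, IsOpen U ∧ x ∈ U ∧ x ∈ P ∧ Δ.InIntegralManifold P ∧
      ∀ (r : ℕ) (N : Type u) (_ : TopologicalSpace N) (_ : ChartedSpace (Euc r) N) (f : N → M),
        Δ.IsIntegralManifold r N f → ∀ W : Set N, IsPreconnected W → f '' W ⊆ U →
          (f '' W ∩ P).Nonempty → f '' W ⊆ P := by
  obtain ⟨r, N₀, i1, i2, f₀, hf₀, y₀, rfl⟩ := hint x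
  have := hf₀.isManifold
  -- In these coordinates the integral manifold through `x` is locally the slice `pr₁ = 0`.
  obtain ⟨k, L, χ, φ, hχ, hφ, hy₀, hs, hL⟩ := hf₀.isImmersion.exists_normalForm y₀
  have hφd := OpenPartialHomeomorph.mdifferentiable_of_mem_maximalAtlas hφ
  have hnf := fun z (hz : z ∈ χ.source) ↦ range_mfderiv_eq_of_normalForm hχ hφ hs hL hz
  have hxφ := hs y₀ hy₀
  -- tangent spaces along the slice
  have hslice : ∀ t ∈ χ.target, t ∈ chartSliceSource L φ 0 ∧
      chartSlice L φ 0 t = f₀ (χ.symm t) ∧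
      (mfderiv (Mdl r) (Mdl n) (chartSlice L φ 0) t).range = Δ (chartSlice L φ 0 t) := by
    intro t ht
    obtain ⟨h1, h2, h3⟩ := hnf _ (χ.map_target ht)
    rw [χ.right_inv ht] at h1 h2 h3
    exact ⟨h1, h2, by rw [← h3, h2, hf₀.tangent]⟩
  set a := χ y₀ with ha
  have haT : a ∈ χ.target := χ.map_source hy₀
  have hxa : chartSlice L φ 0 a = f₀ y₀ := (hnf y₀ hy₀).2.1
  -- a frame of vector fields
  have hframe : ∀ i : Fin r, ∃ U : Set M, IsOpen U ∧ f₀ y₀ ∈ U ∧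
      ∃ X : (y : M) → TangentSpace (Mdl n) y,
        ContMDiffOn (Mdl n) (Mdl n).tangent ∞
          (fun y ↦ (⟨y, X y⟩ : TangentBundle (Mdl n) M)) U ∧ (∀ y ∈ U, X y ∈ Δ y) ∧
        L (mfderiv (Mdl n) (Mdl n) φ (f₀ y₀) (X (f₀ y₀))) =
          (0, EuclideanSpace.single i (1 : ℝ)) := by
    intro i
    let w : Euc r := EuclideanSpace.single i (1 : ℝ)
    have h1 := apply_mfderiv_chartSlice hφ (hslice a haT).1 w
    have h2 : mfderiv (Mdl r) (Mdl n) (chartSlice L φ 0) a w ∈ Δ (chartSlice L φ 0 a) := by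
      rw [← (hslice a haT).2.2]; exact ⟨w, rfl⟩
    obtain ⟨U, hU, hxU, X, hX, hXΔ, hXx⟩ := hsmooth _ _ h2
    rw [← hXx, hxa] at h1
    rw [hxa] at hxU
    exact ⟨U, hU, hxU, X, hX, hXΔ, h1⟩
  choose V hV hxV X hX hXΔ hXx using hframe
  let V₀ : Set M := φ.source ∩ ⋂ i, V i
  have hV₀ : IsOpen V₀ := φ.open_source.inter (isOpen_iInter_of_finite hV)
  have hxV₀ : f₀ y₀ ∈ V₀ := ⟨hxφ, mem_iInter.2 hxV⟩
  let ι : Euc k × Euc r → M := fun p ↦ φ.symm (L.symm p)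
  let T : Set (Euc k × Euc r) := L.symm ⁻¹' (φ.target ∩ φ.symm ⁻¹' V₀)
  have hT : IsOpen T := (φ.isOpen_inter_preimage_symm hV₀).preimage L.symm.continuous
  have hLx : L (φ (f₀ y₀)) = (0, a) := hL y₀ hy₀
  have hιx : ι (0, a) = f₀ y₀ := hxa
  have haT' : ((0 : Euc k), a) ∈ T := by
    refine ⟨(hslice a haT).1, ?_⟩
    change ι (0, a) ∈ V₀
    rwa [hιx]
  let Y : Fin r → Euc k × Euc r → Euc k × Euc r := fun i p ↦
    L (mfderiv (Mdl n) (Mdl n) φ (ι p) (X i (ι p)))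
  have hY : ∀ i, ContDiffOn ℝ ∞ (Y i) T := by
    intro i
    refine L.contDiff.comp_contDiffOn (contMDiffOn_iff_contDiffOn.1
      ((contMDiffOn_mfderiv_chart_apply hφ (hX i)).comp (t := V i ∩ φ.source) (f := ι) ?_ ?_))
    · exact (contMDiffOn_symm_of_mem_maximalAtlas hφ).comp
        L.symm.contDiff.contMDiff.contMDiffOn (fun p hp ↦ hp.1)
    · exact fun p hp ↦ ⟨mem_iInter.1 hp.2.2 i, hp.2.1⟩
  -- `A p` sends coefficients to the corresponding combination of the frame; its range lies in `Δ`,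
  -- which may be larger off the slice.
  let A : Euc k × Euc r → Euc r →L[ℝ] Euc k × Euc r := fun p ↦
    ∑ i, (EuclideanSpace.proj i : Euc r →L[ℝ] ℝ).smulRight (Y i p)
  have hA : ∀ p ξ, A p ξ = ∑ i, ξ i • Y i p := by
    intro p ξ
    simp [A]
  have hAs : ContDiffOn ℝ ∞ A T := by
    refine ContDiffOn.sum fun i _ ↦ ?_
    exact (ContinuousLinearMap.smulRightL ℝ (Euc r) (Euc k × Euc r)
      (EuclideanSpace.proj i)).contDiff.comp_contDiffOn (hY i)
  have hrange : ∀ p ∈ T, ∀ ξ, ∃ v ∈ Δ (ι p), A p ξ = L (mfderiv (Mdl n) (Mdl n) φ (ι p) v) := by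
    intro p hp ξ
    refine ⟨∑ i, ξ i • X i (ι p), Submodule.sum_mem _ fun i _ ↦ Submodule.smul_mem _ _
      (hXΔ i _ (mem_iInter.1 hp.2.2 i)), ?_⟩
    let D : Euc n →ₗ[ℝ] Euc k × Euc r :=
      L.toLinearMap.comp (mfderiv (Mdl n) (Mdl n) φ (ι p)).toLinearMap
    have hD : ∀ w : Fin r → Euc n, D (∑ i, ξ i • w i) = ∑ i, ξ i • D (w i) := by
      intro w; simp [map_sum]
    rw [hA]
    exact (hD _).symm
  have hid : ∀ ξ, (A (0, a) ξ).2 = ξ := by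
    intro ξ
    have h1 : ∀ i, Y i (0, a) = (0, EuclideanSpace.single i (1 : ℝ)) := by
      intro i
      have : ∀ z, z = f₀ y₀ → L (mfderiv (Mdl n) (Mdl n) φ z (X i z)) =
          (0, EuclideanSpace.single i (1 : ℝ)) := by
        rintro _ rfl; exact hXx i
      exact this _ hιx
    rw [hA]
    simp only [h1, Prod.snd_sum, Prod.smul_snd]
    ext j
    simp [Pi.single_apply]
  have hmemT : ∀ᶠ p in 𝓝 ((0 : Euc k), a), p ∈ T ∧ p.2 ∈ χ.target :=
    (hT.eventually_mem haT').and (continuousAt_snd.eventually (χ.open_target.eventually_mem haT))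
  have hzero : ∀ᶠ p in 𝓝 ((0 : Euc k), a), p.1 = 0 → ∀ ξ, (A p ξ).1 = 0 := by
    filter_upwards [hmemT] with p hp hp0 ξ
    obtain ⟨v, hv, hAv⟩ := hrange p hp.1 ξ
    rw [hAv]
    obtain ⟨h1, -, h3⟩ := hslice p.2 hp.2
    have hp' : ι p = chartSlice L φ 0 p.2 := by
      rw [chartSlice, ← hp0]
    rw [hp'] at hv ⊢
    rw [← h3] at hv
    exact (range_mfderiv_chartSlice hφ h1 v).1 hv
  obtain ⟨ε₁, hε₁, K, hK0, hK⟩ := exists_norm_fst_le_of_tangent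
    ((hAs.contDiffAt (hT.mem_nhds haT')).of_le (by simp)) hid hzero
  obtain ⟨ε₂, hε₂, hball₂⟩ := Metric.eventually_nhds_iff_ball.1 hmemT
  set ε := min ε₁ ε₂ with hεdef
  have hε : 0 < ε := lt_min hε₁ hε₂
  let U : Set M := φ.source ∩ φ ⁻¹' (L ⁻¹' Metric.ball (0, a) ε)
  have hU : IsOpen U := φ.isOpen_inter_preimage (Metric.isOpen_ball.preimage L.continuous)
  have hιU : ∀ z ∈ U, ι (L (φ z)) = z := fun z hz ↦ by
    simp [ι, φ.left_inv hz.1]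
  have hxU : f₀ y₀ ∈ U := ⟨hxφ, by
    simp only [mem_preimage, hLx]; exact Metric.mem_ball_self hε⟩
  -- Where the rank of `Δ` is exactly `r`, the independent frame spans `Δ`, so its estimate holds
  -- for every vector of `Δ`.
  have hkey : ∀ z ∈ U, finrank ℝ (Δ z) = r → ∀ v ∈ Δ z,
      ‖(L (mfderiv (Mdl n) (Mdl n) φ z v)).1‖ ≤
        K * ‖(L (φ z)).1‖ * ‖(L (mfderiv (Mdl n) (Mdl n) φ z v)).2‖ := by
    intro z hz hrz v hv
    have hb1 : L (φ z) ∈ Metric.ball ((0 : Euc k), a) ε₁ :=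
      Metric.ball_subset_ball (min_le_left _ _) hz.2
    have hb2 : L (φ z) ∈ T :=
      (hball₂ _ (Metric.ball_subset_ball (min_le_right _ _) hz.2)).1
    have hr' := hrange _ hb2
    rw [hιU z hz] at hr'
    let D : Euc n →ₗ[ℝ] Euc k × Euc r :=
      L.toLinearMap.comp (mfderiv (Mdl n) (Mdl n) φ z).toLinearMap
    have hle : (A (L (φ z))).range ≤ Submodule.map D (Δ z) := by
      rintro _ ⟨ξ, rfl⟩
      obtain ⟨v, hv, hAv⟩ := hr' ξ
      exact ⟨v, hv, hAv.symm⟩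
    have hinj : Function.Injective (A (L (φ z))).toLinearMap := by
      rw [← LinearMap.ker_eq_bot, LinearMap.ker_eq_bot']
      intro ξ hξ
      have h1 := (hK _ hb1 ξ).1
      have h2 : A (L (φ z)) ξ = 0 := hξ
      rw [h2] at h1
      simpa using h1
    have hfr : finrank ℝ (Submodule.map D (Δ z)) ≤ finrank ℝ (A (L (φ z))).range := by
      have h1 := LinearMap.finrank_range_of_inj hinj
      rw [finrank_euclideanSpace, Fintype.card_fin] at h1
      let S : Submodule ℝ (Euc n) := Δ z
      have h2 : finrank ℝ (Submodule.map D S) ≤ finrank ℝ S := Submodule.finrank_map_le D S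
      change finrank ℝ S = r at hrz
      rw [hrz] at h2
      exact h2.trans h1.ge
    have heq := Submodule.eq_of_le_of_finrank_le hle hfr
    obtain ⟨ξ, hξ⟩ : D v ∈ (A (L (φ z))).range := by
      rw [heq]; exact ⟨v, hv, rfl⟩
    have h1 : A (L (φ z)) ξ = L (mfderiv (Mdl n) (Mdl n) φ z v) := hξ
    have h2 := (hK _ hb1 ξ).2
    rwa [h1] at h2
  let P : Set M := U ∩ {z | (L (φ z)).1 = 0}
  have hPf : P ⊆ range f₀ := by
    rintro z ⟨hz, hz0⟩
    have h1 := (hball₂ _ (Metric.ball_subset_ball (min_le_right _ _) hz.2)).2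
    refine ⟨χ.symm (L (φ z)).2, ?_⟩
    rw [← (hslice _ h1).2.1]
    have h2 := chartSlice_apply (L := L) hz.1
    have hz0' : (L (φ z)).1 = 0 := hz0
    rwa [hz0'] at h2
  refine ⟨U, P, hU, hxU, ⟨hxU, by simp [hLx]⟩, ⟨r, N₀, i1, i2, f₀, hf₀, hPf⟩, ?_⟩
  rintro r' N j1 j2 f hf W hW hWU ⟨_, ⟨w, hw, rfl⟩, hwP⟩
  -- Both dimensions are the rank of `Δ` at the common point, so the estimate is available all along
  -- `f`.
  have hr' : r' = r := by
    rw [← hf.finrank_eq w]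
    obtain ⟨y, hy⟩ := hPf hwP
    rw [← hy, hf₀.finrank_eq y]
  have hopen : IsOpen (f ⁻¹' P) := hf.isOpen_preimage_slice hφ hU (fun z hz ↦ hz.1) hK0
    fun z hz v hv ↦ hkey _ hz ((hf.finrank_eq z).trans hr') v hv
  -- The preimage of `P` is open, and it is relatively closed in `W` because `P` is given in `U` by
  -- an equation; `W` is preconnected.
  have hsub : W ⊆ f ⁻¹' P := by
    refine hW.subset_of_closure_inter_subset hopen ⟨w, hw, hwP⟩ ?_
    rintro z ⟨hzc, hzW⟩
    have hzU : f z ∈ U := hWU ⟨z, hzW, rfl⟩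
    refine ⟨hzU, ?_⟩
    have := hf.isManifold
    have hc : ContinuousAt (fun z ↦ (L (φ (f z))).1) z :=
      continuous_fst.continuousAt.comp (L.continuous.continuousAt.comp
        ((φ.continuousAt hzU.1).comp hf.isImmersion.contMDiff'.continuous.continuousAt))
    have h1 := mem_closure_image hc hzc
    have h2 : (fun z ↦ (L (φ (f z))).1) '' (f ⁻¹' P) ⊆ {0} := by
      rintro _ ⟨y, hy, rfl⟩
      exact hy.2
    exact closure_minimal h2 isClosed_singleton h1
  rintro _ ⟨z, hz, rfl⟩
  exact hsub hz

end TangentDistribution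

/-! ### Plaques, countable covers of leaves, and the kernel of dq_Δ -/

namespace TangentDistribution

variable {n : ℕ} {M : Type u} [TopologicalSpace M] [ChartedSpace (Euc n) M]
  {Δ : TangentDistribution n M}

/-- The equivalence relation generated by lying on a common preconnected piece of an integral
manifold inside `V`. -/
def chainSetoid (Δ : TangentDistribution n M) (V : Set M) : Setoid M :=
  Relation.EqvGen.setoid fun a b ↦
    ∃ (r : ℕ) (N : Type u) (_ : TopologicalSpace N) (_ : ChartedSpace (Euc r) N) (f : N → M),
      Δ.IsIntegralManifold r N f ∧ ∃ W : Set N, IsPreconnected W ∧ f '' W ⊆ V ∧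
        a ∈ f '' W ∧ b ∈ f '' W

/-- The plaque of `V` through `y`. -/
def plaque (Δ : TangentDistribution n M) (V : Set M) (y : M) : Set M := {z | Δ.chainSetoid V y z}

theorem mem_plaque_self (V : Set M) (y : M) : y ∈ Δ.plaque V y := (Δ.chainSetoid V).refl y

theorem plaque_eq_of_mem {V : Set M} {y z : M} (h : z ∈ Δ.plaque V y) :
    Δ.plaque V z = Δ.plaque V y := by
  ext w
  exact ⟨fun hw ↦ (Δ.chainSetoid V).trans h hw,
    fun hw ↦ (Δ.chainSetoid V).trans ((Δ.chainSetoid V).symm h) hw⟩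

/-- The generating relation links only points of `V`; a point outside `V` is alone in its class. -/
theorem plaque_subset {V : Set M} {y : M} (hy : y ∈ V) : Δ.plaque V y ⊆ V := by
  have key : ∀ {a b : M}, Δ.chainSetoid V a b → (a ∈ V ↔ b ∈ V) := by
    intro a b h
    induction h with
    | rel a b h =>
      obtain ⟨r, N, i1, i2, f, hf, W, hW, hWV, ha, hb⟩ := h
      exact iff_of_true (hWV ha) (hWV hb)
    | refl => exact Iff.rfl
    | symm _ _ _ ih => exact ih.symm
    | trans _ _ _ _ _ ih₁ ih₂ => exact ih₁.trans ih₂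
  exact fun z hz ↦ (key hz).1 hy

/-- `N` is locally connected, so each point of the preimage has a connected neighbourhood mapped
into `V`, which is a single link of a chain. -/
theorem IsIntegralManifold.isOpen_preimage_plaque {r : ℕ} {N : Type u} [TopologicalSpace N]
    [ChartedSpace (Euc r) N] {f : N → M} (hf : Δ.IsIntegralManifold r N f) {V : Set M}
    (hV : IsOpen V) {y : M} (hy : y ∈ V) : IsOpen (f ⁻¹' Δ.plaque V y) := by
  have : LocallyConnectedSpace N := ChartedSpace.locallyConnectedSpace (Euc r) N
  rw [isOpen_iff_mem_nhds]
  intro w hw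
  have hwV : f w ∈ V := plaque_subset hy hw
  have hfV : f ⁻¹' V ∈ 𝓝 w :=
    (hV.preimage hf.isImmersion.contMDiff'.continuous).mem_nhds hwV
  obtain ⟨W, hW, hWo, hwW, hWc⟩ :=
    (locallyConnectedSpace_iff_subsets_isOpen_isConnected.1 this) w _ hfV
  filter_upwards [hWo.mem_nhds hwW] with z hz
  refine (Δ.chainSetoid V).trans hw (Relation.EqvGen.rel _ _
    ⟨r, N, inferInstance, inferInstance, f, hf, W, hWc.isPreconnected, image_subset_iff.2 hW,
      ⟨w, hwW, rfl⟩, ⟨z, hz, rfl⟩⟩)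

/-- Within the neighbourhood of `exists_localLeaf`, no link of a chain can enter or leave the local
leaf. -/
theorem exists_plaque_subset [IsManifold (Mdl n) ∞ M] (hsmooth : Δ.IsSmooth)
    (hint : Δ.IsIntegrable) {B : Set (Set M)}
    (hB : TopologicalSpace.IsTopologicalBasis B) (x : M) :
    ∃ V ∈ B, x ∈ V ∧ Δ.InIntegralManifold (Δ.plaque V x) := by
  obtain ⟨U, P, hU, hxU, hxP, ⟨r, N₀, i1, i2, f₀, hf₀, hPf⟩, hP⟩ := exists_localLeaf hsmooth hint x
  obtain ⟨V, hVB, hxV, hVU⟩ := hB.exists_subset_of_mem_open hxU hU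
  refine ⟨V, hVB, hxV, r, N₀, i1, i2, f₀, hf₀, fun z hz ↦ hPf ?_⟩
  have key : ∀ {a b : M}, Δ.chainSetoid V a b → (a ∈ P ↔ b ∈ P) := by
    intro a b h
    induction h with
    | rel a b h =>
      obtain ⟨r, N, i1, i2, f, hf, W, hW, hWV, ha, hb⟩ := h
      have h1 := hP r N i1 i2 f hf W hW (hWV.trans hVU)
      exact ⟨fun h ↦ h1 ⟨a, ha, h⟩ hb, fun h ↦ h1 ⟨b, hb, h⟩ ha⟩
    | refl => exact Iff.rfl
    | symm _ _ _ ih => exact ih.symm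
    | trans _ _ _ _ _ ih₁ ih₂ => exact ih₁.trans ih₂
  exact (key hz).1 hxP

/-- A set contained in an integral manifold meets only countably many plaques of a given open
set. -/
theorem countable_plaques_meeting {A V : Set M} (hA : Δ.InIntegralManifold A)
    (hV : IsOpen V) : {P | (∃ y ∈ V, P = Δ.plaque V y) ∧ (P ∩ A).Nonempty}.Countable := by
  obtain ⟨r, N, i1, i2, f, hf, hAf⟩ := hA
  have := hf.secondCountable
  -- Distinct plaques have disjoint open preimages in the second countable `N`.
  refine PairwiseDisjoint.countable_of_isOpen (s := fun P ↦ f ⁻¹' P) ?_ ?_ ?_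
  · rintro _ ⟨⟨y, hy, rfl⟩, -⟩ _ ⟨⟨z, hz, rfl⟩, -⟩ hne
    refine (disjoint_left.2 fun w hw₁ hw₂ ↦ hne ?_).preimage f
    rw [← plaque_eq_of_mem hw₁, ← plaque_eq_of_mem hw₂]
  · rintro _ ⟨⟨y, hy, rfl⟩, -⟩
    exact hf.isOpen_preimage_plaque hV hy
  · rintro P ⟨-, x, hxP, hxA⟩
    obtain ⟨w, rfl⟩ := hAf hxA
    exact ⟨w, hxP⟩

/-- A maximal connected integral manifold is a countable union of pieces of integral manifolds. -/
theorem exists_countable_cover_leaf [IsManifold (Mdl n) ∞ M] [SecondCountableTopology M]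
    (hsmooth : Δ.IsSmooth) (hint : Δ.IsIntegrable) (x : M) :
    ∃ S : Set (Set M), S.Countable ∧ (∀ A ∈ S, Δ.InIntegralManifold A) ∧
      {z | Δ.leafSetoid x z} ⊆ ⋃₀ S := by
  let B := TopologicalSpace.countableBasis M
  have hB : TopologicalSpace.IsTopologicalBasis B := TopologicalSpace.isBasis_countableBasis M
  let Good : Set M → Prop := fun A ↦
    (∃ V ∈ B, ∃ y ∈ V, A = Δ.plaque V y) ∧ Δ.InIntegralManifold A
  have hgood : ∀ z, ∃ V ∈ B, z ∈ V ∧ Good (Δ.plaque V z) := fun z ↦ by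
    obtain ⟨V, hV, hz, h⟩ := exists_plaque_subset hsmooth hint hB z
    exact ⟨V, hV, hz, ⟨V, hV, z, hz, rfl⟩, h⟩
  have hopen : ∀ A, Good A → ∀ (r : ℕ) (N : Type u) (_ : TopologicalSpace N)
      (_ : ChartedSpace (Euc r) N) (f : N → M), Δ.IsIntegralManifold r N f → IsOpen (f ⁻¹' A) := by
    rintro _ ⟨⟨V, hV, y, hy, rfl⟩, -⟩ r N i1 i2 f hf
    exact hf.isOpen_preimage_plaque (hB.isOpen hV) hy
  -- Each stage collects the good plaques meeting one of the previous stage. It stays countable: the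
  -- open sets come from a countable basis, and each earlier plaque meets countably many plaques of
  -- each.
  let next : Set (Set M) → Set (Set M) := fun S ↦ {P | Good P ∧ ∃ A ∈ S, (P ∩ A).Nonempty}
  obtain ⟨V₀, hV₀, hxV₀, hgood₀⟩ := hgood x
  let S : ℕ → Set (Set M) := fun i ↦ next^[i] {Δ.plaque V₀ x}
  have hS : ∀ i, (S i).Countable ∧ ∀ A ∈ S i, Good A := by
    intro i
    induction i with
    | zero =>
      refine ⟨countable_singleton _, ?_⟩
      rintro _ rfl
      exact hgood₀
    | succ i ih =>
      have hi : S (i + 1) = next (S i) := Function.iterate_succ_apply' _ _ _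
      rw [hi]
      refine ⟨?_, fun A hA ↦ hA.1⟩
      refine Countable.mono ?_ (ih.1.biUnion fun A hA ↦
        (TopologicalSpace.countable_countableBasis M).biUnion fun V hV ↦
          countable_plaques_meeting (ih.2 A hA).2 (hB.isOpen hV))
      rintro P ⟨⟨⟨V, hV, hP⟩, -⟩, A, hA, hPA⟩
      exact mem_iUnion₂.2 ⟨A, hA, mem_iUnion₂.2 ⟨V, hV, hP, hPA⟩⟩
  refine ⟨⋃ i, S i, countable_iUnion fun i ↦ (hS i).1, ?_, ?_⟩
  · rintro A hA
    obtain ⟨i, hi⟩ := mem_iUnion.1 hA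
    exact ((hS i).2 A hi).2
  set T := ⋃₀ ⋃ i, S i with hT
  have hmeet : ∀ P, Good P → (P ∩ T).Nonempty → P ⊆ T := by
    rintro P hP ⟨z, hzP, A, hA, hzA⟩
    obtain ⟨i, hi⟩ := mem_iUnion.1 hA
    have : P ∈ S (i + 1) := by
      change P ∈ next^[i + 1] _
      rw [Function.iterate_succ_apply']
      exact ⟨hP, A, hi, z, hzP, hzA⟩
    exact subset_sUnion_of_mem (mem_iUnion.2 ⟨i + 1, this⟩)
  have key : ∀ {a b : M}, Δ.leafSetoid a b → (a ∈ T ↔ b ∈ T) := by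
    intro a b h
    induction h with
    | rel a b h =>
      obtain ⟨r, N, i1, i2, f, hf, hN, ⟨w, rfl⟩, ⟨w', rfl⟩⟩ := h
      -- `T` is a union of good plaques and contains every good plaque it meets; good plaques cover
      -- `M` and have open preimages.
      have hcl : IsClopen (f ⁻¹' T) := by
        constructor
        · rw [← isOpen_compl_iff, isOpen_iff_forall_mem_open]
          intro z hz
          obtain ⟨V, hV, hzV, hP⟩ := hgood (f z)
          refine ⟨f ⁻¹' Δ.plaque V (f z), fun y hy hyT ↦ hz ?_, hopen _ hP r N i1 i2 f hf,
            mem_plaque_self V (f z)⟩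
          exact hmeet _ hP ⟨f y, hy, hyT⟩ (mem_plaque_self V (f z))
        · rw [hT, preimage_sUnion]
          refine isOpen_biUnion fun A hA ↦ ?_
          obtain ⟨i, hi⟩ := mem_iUnion.1 hA
          exact hopen A ((hS i).2 A hi) r N i1 i2 f hf
      rcases isClopen_iff.1 hcl with h | h
      · exact iff_of_false (fun hw ↦ (h ▸ hw : w ∈ (∅ : Set N)))
          (fun hw ↦ (h ▸ hw : w' ∈ (∅ : Set N)))
      · have h1 : ∀ w, w ∈ f ⁻¹' T := fun w ↦ h ▸ mem_univ w
        exact iff_of_true (h1 w) (h1 w')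
    | refl => exact Iff.rfl
    | symm _ _ _ ih => exact ih.symm
    | trans _ _ _ _ _ ih₁ ih₂ => exact ih₁.trans ih₂
  intro z hz
  exact (key hz).1 ⟨_, mem_iUnion.2 ⟨0, rfl⟩, mem_plaque_self V₀ x⟩

variable [IsManifold (Mdl n) ∞ M]

theorem finrank_eq_of_leafSetoid {x y : M} (h : Δ.leafSetoid x y) :
    finrank ℝ (Δ x) = finrank ℝ (Δ y) := by
  induction h with
  | rel a b h =>
    obtain ⟨r, N, i1, i2, f, hf, hN, ⟨w, rfl⟩, ⟨w', rfl⟩⟩ := h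
    rw [hf.finrank_eq, hf.finrank_eq]
  | refl => rfl
  | symm _ _ _ ih => exact ih.symm
  | trans _ _ _ _ _ ih₁ ih₂ => exact ih₁.trans ih₂

/-- If the leaf space is a manifold, then `Δ` is the kernel of the derivative of the projection. -/
theorem ker_mfderiv_leafProj [SecondCountableTopology M] (hsmooth : Δ.IsSmooth)
    (hint : Δ.IsIntegrable) {m : ℕ} [ChartedSpace (Euc m) Δ.LeafSpace]
    [IsManifold (Mdl m) ∞ Δ.LeafSpace] (hq : IsSubmersion (Mdl n) (Mdl m) ∞ Δ.leafProj) (x : M) :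
    (mfderiv (Mdl n) (Mdl m) Δ.leafProj x).ker = Δ x := by
  let S : Submodule ℝ (Euc n) := Δ x
  let A : Euc n →L[ℝ] Euc m := mfderiv (Mdl n) (Mdl m) Δ.leafProj x
  have hle : S ≤ A.ker := le_ker_mfderiv_leafProj hint hq.contMDiff' x
  refine (Submodule.eq_of_le_of_finrank_le hle ?_).symm
  refine hq.finrank_ker_le x ?_
  have hfib : Δ.leafProj ⁻¹' {Δ.leafProj x} = {z | Δ.leafSetoid x z} := by
    ext z
    exact ⟨fun h ↦ Δ.leafSetoid.symm (Quotient.exact h),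
      fun h ↦ Quotient.sound (Δ.leafSetoid.symm h)⟩
  rw [hfib]
  obtain ⟨C, hC, hCi, hcov⟩ := exists_countable_cover_leaf hsmooth hint x
  -- Pieces meeting the leaf lie in integral manifolds whose dimension is the rank of `Δ` at `x`;
  -- the others contribute nothing.
  refine (ManifoldDimLE.biUnion hC (S := fun A ↦ {z | Δ.leafSetoid x z} ∩ A)
    fun A hA ↦ ?_).mono fun z hz ↦ ?_
  · rcases ({z | Δ.leafSetoid x z} ∩ A).eq_empty_or_nonempty with h | ⟨z, hxz, hzA⟩
    · rw [h]; intro φ _; simp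
    · obtain ⟨r, N, i1, i2, f, hf, hAf⟩ := hCi A hA
      have := hf.isManifold
      have := hf.secondCountable
      have hr : finrank ℝ S = r := by
        obtain ⟨w, rfl⟩ := hAf hzA
        exact (finrank_eq_of_leafSetoid hxz).trans (hf.finrank_eq w)
      rw [hr]
      refine (manifoldDimLE_image_of_rank_eq isOpen_univ
        hf.isImmersion.contMDiff'.contMDiffOn fun y _ ↦ ?_).mono
          (inter_subset_right.trans (hAf.trans image_univ.ge))
      rw [hf.tangent]
      exact hf.finrank_eq y
  · obtain ⟨A, hA, hzA⟩ := hcov hz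
    exact mem_iUnion₂.2 ⟨A, hA, hz, hzA⟩

end TangentDistribution

/-! ### Orbit projections and kernels in normal form -/

theorem orbitProj_surjective (G M : Type*) [Group G] [MulAction G M] :
    Function.Surjective (orbitProj G M) := Quotient.mk_surjective

theorem orbitProj_eq_iff {G M : Type*} [Group G] [MulAction G M] {x y : M} :
    orbitProj G M x = orbitProj G M y ↔ ∃ g : G, g • y = x := by
  refine ⟨fun h ↦ Quotient.exact h, fun h ↦ Quotient.sound h⟩

theorem orbitProj_smul {G M : Type*} [Group G] [MulAction G M] (g : G) (x : M) :
    orbitProj G M (g • x) = orbitProj G M x := orbitProj_eq_iff.2 ⟨g, rfl⟩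

section

variable {n k : ℕ} {M : Type*} [TopologicalSpace M] [ChartedSpace (Euc n) M]
  [IsManifold (Mdl n) ∞ M]
  {N : Type*} [TopologicalSpace N] [ChartedSpace (Euc k) N] [IsManifold (Mdl k) ∞ N]

/-- In the normal form of a submersion, the kernel of its derivative is the kernel of the
projection. -/
theorem mem_ker_mfderiv_iff_of_normalForm {q : M → N} (hq : ContMDiff (Mdl n) (Mdl k) ∞ q)
    {d : ℕ} {L : Euc n ≃L[ℝ] Euc k × Euc d} {φ : OpenPartialHomeomorph M (Euc n)}
    {ψ : OpenPartialHomeomorph N (Euc k)}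
    (hφ : φ ∈ IsManifold.maximalAtlas (Mdl n) ∞ M) (hψ : ψ ∈ IsManifold.maximalAtlas (Mdl k) ∞ N)
    (hsub : ∀ y ∈ φ.source, q y ∈ ψ.source) (hL : ∀ y ∈ φ.source, ψ (q y) = (L (φ y)).1)
    {y : M} (hy : y ∈ φ.source) (v : TangentSpace (Mdl n) y) :
    v ∈ (mfderiv (Mdl n) (Mdl k) q y).ker ↔ (L (mfderiv (Mdl n) (Mdl n) φ y v)).1 = 0 := by
  have hφd := OpenPartialHomeomorph.mdifferentiable_of_mem_maximalAtlas hφ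
  have hψd := OpenPartialHomeomorph.mdifferentiable_of_mem_maximalAtlas hψ
  have h1 : HasMFDerivAt (Mdl n) (Mdl k) q y _ :=
    (hq.contMDiffAt.mdifferentiableAt (by simp)).hasMFDerivAt
  have h2 := (hψd.mdifferentiableAt (hsub y hy)).hasMFDerivAt.comp y h1
  let P : Euc n →L[ℝ] Euc k := (ContinuousLinearMap.fst ℝ _ _).comp L.toContinuousLinearMap
  have h3 : HasMFDerivAt (Mdl n) (Mdl k) (ψ ∘ q) y _ :=
    ((P.hasFDerivAt (x := φ y)).hasMFDerivAt.comp y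
      (hφd.mdifferentiableAt hy).hasMFDerivAt).congr_of_eventuallyEq <| by
        filter_upwards [φ.open_source.mem_nhds hy] with z hz using hL z hz
  have h4 : mfderiv (Mdl k) (Mdl k) ψ (q y) (mfderiv (Mdl n) (Mdl k) q y v) =
      (L (mfderiv (Mdl n) (Mdl n) φ y v)).1 := congrArg (fun A ↦ A v) (hasMFDerivAt_unique h2 h3)
  constructor
  · intro hv
    have hv' : mfderiv (Mdl n) (Mdl k) q y v = 0 := hv
    rw [← h4, hv']
    exact map_zero _
  · intro hv
    refine hψd.mfderiv_injective (hsub y hy) ?_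
    exact (h4.trans hv).trans (map_zero (mfderiv (Mdl k) (Mdl k) ψ (q y))).symm

end

/-! ### Equivariant submersions and the induced map of orbit spaces -/

section EquivariantSubmersions

variable {n m k i : ℕ} {G : Type*} [Group G]
  {M : Type*} [TopologicalSpace M] [ChartedSpace (Euc n) M] [IsManifold (Mdl n) ∞ M]
  [MulAction G M]
  {B : Type*} [TopologicalSpace B] [ChartedSpace (Euc m) B] [IsManifold (Mdl m) ∞ B]
  [MulAction G B]
  [ChartedSpace (Euc k) (MulAction.orbitRel.Quotient G M)]
  [IsManifold (Mdl k) ∞ (MulAction.orbitRel.Quotient G M)]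
  {q : M → B}

omit [IsManifold (Mdl k) ∞ (MulAction.orbitRel.Quotient G M)] in
/-- The rank of an equivariant submersion along an orbit is constant. -/
theorem finrank_map_ker_mfderiv_orbitProj_smul (hq : IsSubmersion (Mdl n) (Mdl m) ∞ q)
    (hqs : Function.Surjective q) (hequiv : ∀ (g : G) x, q (g • x) = g • q x)
    (hsm : ∀ g : G, ContMDiff (Mdl n) (Mdl n) ∞ fun x : M ↦ g • x)
    (hG : ContMDiff (Mdl n) (Mdl k) ∞ (orbitProj G M)) (g : G) (x : M) :
    finrank ℝ ((mfderiv (Mdl n) (Mdl k) (orbitProj G M) (g • x)).ker.map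
      (mfderiv (Mdl n) (Mdl m) q (g • x)).toLinearMap) =
    finrank ℝ ((mfderiv (Mdl n) (Mdl k) (orbitProj G M) x).ker.map
      (mfderiv (Mdl n) (Mdl m) q x).toLinearMap) := by
  -- Smoothness on `B` is inherited from `M` through the surjective submersion `q`.
  have hsmB : ∀ g : G, ContMDiff (Mdl m) (Mdl m) ∞ fun b : B ↦ g • b := fun g ↦ by
    refine hq.contMDiff_of_comp hqs ?_
    have : (fun b : B ↦ g • b) ∘ q = q ∘ fun x : M ↦ g • x := by
      ext x; exact (hequiv g x).symm
    rw [this]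
    exact hq.contMDiff'.comp (hsm g)
  have hdM : ∀ (g : G) x, HasMFDerivAt (Mdl n) (Mdl n) (fun x : M ↦ g • x) x _ := fun g x ↦
    ((hsm g).contMDiffAt.mdifferentiableAt (by simp)).hasMFDerivAt
  have hdB : ∀ (g : G) b, HasMFDerivAt (Mdl m) (Mdl m) (fun b : B ↦ g • b) b _ := fun g x ↦
    ((hsmB g).contMDiffAt.mdifferentiableAt (by simp)).hasMFDerivAt
  have hdq : ∀ x, HasMFDerivAt (Mdl n) (Mdl m) q x _ := fun x ↦
    (hq.contMDiff'.contMDiffAt.mdifferentiableAt (by simp)).hasMFDerivAt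
  have hdG : ∀ x, HasMFDerivAt (Mdl n) (Mdl k) (orbitProj G M) x _ := fun x ↦
    (hG.contMDiffAt.mdifferentiableAt (by simp)).hasMFDerivAt
  let μ : Euc n →L[ℝ] Euc n := mfderiv (Mdl n) (Mdl n) (fun x : M ↦ g • x) x
  let ν : Euc m →L[ℝ] Euc m := mfderiv (Mdl m) (Mdl m) (fun b : B ↦ g • b) (q x)
  let Q₁ : Euc n →L[ℝ] Euc m := mfderiv (Mdl n) (Mdl m) q x
  let Q₂ : Euc n →L[ℝ] Euc m := mfderiv (Mdl n) (Mdl m) q (g • x)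
  let O₁ : Euc n →L[ℝ] Euc k := mfderiv (Mdl n) (Mdl k) (orbitProj G M) x
  let O₂ : Euc n →L[ℝ] Euc k := mfderiv (Mdl n) (Mdl k) (orbitProj G M) (g • x)
  have hμ : Function.Injective μ := by
    have h1 := (hdM g⁻¹ (g • x)).comp x (hdM g x)
    have h2 : HasMFDerivAt (Mdl n) (Mdl n) ((fun x : M ↦ g⁻¹ • x) ∘ fun x : M ↦ g • x) x
        (ContinuousLinearMap.id ℝ _) := by
      have : ((fun x : M ↦ g⁻¹ • x) ∘ fun x : M ↦ g • x) = id := by ext; simp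
      rw [this]; exact hasMFDerivAt_id x
    have h3 := hasMFDerivAt_unique h1 h2
    exact Function.LeftInverse.injective
      (g := mfderiv (Mdl n) (Mdl n) (fun x : M ↦ g⁻¹ • x) (g • x)) fun v ↦
        congrArg (fun A ↦ A v) h3
  have hν : Function.Injective ν := by
    have h1 := (hdB g⁻¹ (g • q x)).comp (q x) (hdB g (q x))
    have h2 : HasMFDerivAt (Mdl m) (Mdl m) ((fun x : B ↦ g⁻¹ • x) ∘ fun x : B ↦ g • x) (q x)
        (ContinuousLinearMap.id ℝ _) := by
      have : ((fun x : B ↦ g⁻¹ • x) ∘ fun x : B ↦ g • x) = id := by ext; simp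
      rw [this]; exact hasMFDerivAt_id _
    have h3 := hasMFDerivAt_unique h1 h2
    exact Function.LeftInverse.injective
      (g := mfderiv (Mdl m) (Mdl m) (fun x : B ↦ g⁻¹ • x) (g • q x)) fun v ↦
        congrArg (fun A ↦ A v) h3
  have hμs : Function.Surjective μ := LinearMap.injective_iff_surjective.1 hμ
  have hQ : Q₂.comp μ = ν.comp Q₁ := by
    have h1 := (hdq (g • x)).comp x (hdM g x)
    have h2 : HasMFDerivAt (Mdl n) (Mdl m) (q ∘ fun x : M ↦ g • x) x _ :=
      ((hdB g (q x)).comp x (hdq x)).congr_of_eventuallyEq (.of_forall fun y ↦ hequiv g y)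
    exact hasMFDerivAt_unique h1 h2
  have hO : O₂.comp μ = O₁ := by
    have h1 := (hdG (g • x)).comp x (hdM g x)
    have h2 : HasMFDerivAt (Mdl n) (Mdl k) (orbitProj G M ∘ fun x : M ↦ g • x) x _ :=
      (hdG x).congr_of_eventuallyEq (.of_forall fun y ↦ orbitProj_smul g y)
    exact hasMFDerivAt_unique h1 h2
  -- The bijection `μ` matches the two kernels and intertwines `Q₁` with `Q₂` up to the injective
  -- map `ν`.
  have hmap : Submodule.map Q₂.toLinearMap O₂.ker =
      Submodule.map ν.toLinearMap (Submodule.map Q₁.toLinearMap O₁.ker) := by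
    ext w
    constructor
    · rintro ⟨v, hv, rfl⟩
      obtain ⟨u, rfl⟩ := hμs v
      refine ⟨Q₁ u, ⟨u, ?_, rfl⟩, (congrArg (fun A ↦ A u) hQ).symm⟩
      have : O₂.comp μ u = 0 := hv
      rw [hO] at this
      exact this
    · rintro ⟨_, ⟨u, hu, rfl⟩, rfl⟩
      refine ⟨μ u, ?_, congrArg (fun A ↦ A u) hQ⟩
      have : O₁ u = 0 := hu
      rw [← hO] at this
      exact this
  change finrank ℝ (Submodule.map Q₂.toLinearMap O₂.ker) =
    finrank ℝ (Submodule.map Q₁.toLinearMap O₁.ker)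
  rw [hmap]
  exact (Submodule.equivMapOfInjective ν.toLinearMap hν _).finrank_eq.symm

variable [ChartedSpace (Euc i) (MulAction.orbitRel.Quotient G B)]
  [IsManifold (Mdl i) ∞ (MulAction.orbitRel.Quotient G B)]
  {p : MulAction.orbitRel.Quotient G M → MulAction.orbitRel.Quotient G B}

omit [IsManifold (Mdl m) ∞ B] [IsManifold (Mdl i) ∞ (MulAction.orbitRel.Quotient G B)] in
theorem contMDiff_orbitMap (hq : ContMDiff (Mdl n) (Mdl m) ∞ q)
    (hG : IsSubmersion (Mdl n) (Mdl k) ∞ (orbitProj G M))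
    (hG' : ContMDiff (Mdl m) (Mdl i) ∞ (orbitProj G B))
    (hp : ∀ x, p (orbitProj G M x) = orbitProj G B (q x)) :
    ContMDiff (Mdl k) (Mdl i) ∞ p := by
  refine hG.contMDiff_of_comp (orbitProj_surjective G M) ?_
  have : p ∘ orbitProj G M = orbitProj G B ∘ q := funext hp
  rw [this]
  exact hG'.comp hq

omit [IsManifold (Mdl m) ∞ B] [IsManifold (Mdl i) ∞ (MulAction.orbitRel.Quotient G B)] in
/-- The chain rule for the square of an equivariant map and the orbit projections. -/
theorem mfderiv_orbitMap_apply (hq : ContMDiff (Mdl n) (Mdl m) ∞ q)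
    (hG : IsSubmersion (Mdl n) (Mdl k) ∞ (orbitProj G M))
    (hG' : ContMDiff (Mdl m) (Mdl i) ∞ (orbitProj G B))
    (hp : ∀ x, p (orbitProj G M x) = orbitProj G B (q x)) (x : M) (v : Euc n) :
    (mfderiv (Mdl k) (Mdl i) p (orbitProj G M x)
      (mfderiv (Mdl n) (Mdl k) (orbitProj G M) x v) : Euc i) =
    mfderiv (Mdl m) (Mdl i) (orbitProj G B) (q x) (mfderiv (Mdl n) (Mdl m) q x v) := by
  have hps := contMDiff_orbitMap hq hG hG' hp
  have h1 := (hps.contMDiffAt.mdifferentiableAt (x := orbitProj G M x) (by simp)).hasMFDerivAt.comp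
    x (hG.contMDiff'.contMDiffAt.mdifferentiableAt (x := x) (by simp)).hasMFDerivAt
  have h2 : HasMFDerivAt (Mdl n) (Mdl i) (p ∘ orbitProj G M) x _ :=
    ((hG'.contMDiffAt.mdifferentiableAt (x := q x) (by simp)).hasMFDerivAt.comp x
      (hq.contMDiffAt.mdifferentiableAt (x := x) (by simp)).hasMFDerivAt).congr_of_eventuallyEq
        (.of_forall hp)
  exact congrArg (fun A ↦ A v) (hasMFDerivAt_unique h1 h2)

/-- An equivariant submersion maps the tangent spaces of the orbits onto the tangent spaces of the
orbits. -/
theorem map_ker_mfderiv_orbitProj [SecondCountableTopology M]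
    (hq : IsSubmersion (Mdl n) (Mdl m) ∞ q)
    (hqs : Function.Surjective q) (hequiv : ∀ (g : G) x, q (g • x) = g • q x)
    (hsm : ∀ g : G, ContMDiff (Mdl n) (Mdl n) ∞ fun x : M ↦ g • x)
    (hG : IsSubmersion (Mdl n) (Mdl k) ∞ (orbitProj G M))
    (hG' : IsSubmersion (Mdl m) (Mdl i) ∞ (orbitProj G B))
    (hp : ∀ x, p (orbitProj G M x) = orbitProj G B (q x)) (x : M) :
    (mfderiv (Mdl n) (Mdl k) (orbitProj G M) x).ker.map
      (mfderiv (Mdl n) (Mdl m) q x).toLinearMap =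
    (mfderiv (Mdl m) (Mdl i) (orbitProj G B) (q x)).ker := by
  let Q : Euc n →L[ℝ] Euc m := mfderiv (Mdl n) (Mdl m) q x
  let O : Euc n →L[ℝ] Euc k := mfderiv (Mdl n) (Mdl k) (orbitProj G M) x
  let O' : Euc m →L[ℝ] Euc i := mfderiv (Mdl m) (Mdl i) (orbitProj G B) (q x)
  have hle : Submodule.map Q.toLinearMap O.ker ≤ O'.ker := by
    rintro _ ⟨v, hv, rfl⟩
    have h1 := mfderiv_orbitMap_apply hq.contMDiff' hG hG'.contMDiff' hp x v
    have h2 : mfderiv (Mdl n) (Mdl k) (orbitProj G M) x v = 0 := hv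
    rw [h2] at h1
    exact h1.symm.trans (map_zero _)
  change Submodule.map Q.toLinearMap O.ker = O'.ker
  -- For the other inclusion, the orbit of `q x` must have dimension at most the rank `ρ` of `q` on
  -- the tangent space of the orbit of `x`.
  refine Submodule.eq_of_le_of_finrank_le hle (hG'.finrank_ker_le (q x) ?_)
  set ρ := finrank ℝ (Submodule.map Q.toLinearMap O.ker) with hρ
  have hrank : ∀ y, orbitProj G M y = orbitProj G M x →
      finrank ℝ ((mfderiv (Mdl n) (Mdl k) (orbitProj G M) y).ker.map
        (mfderiv (Mdl n) (Mdl m) q y).toLinearMap) = ρ := by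
    intro y hy
    obtain ⟨g, rfl⟩ := orbitProj_eq_iff.1 hy
    exact finrank_map_ker_mfderiv_orbitProj_smul hq hqs hequiv hsm hG.contMDiff' g x
  have hfib : orbitProj G B ⁻¹' {orbitProj G B (q x)} ⊆
      q '' (orbitProj G M ⁻¹' {orbitProj G M x}) := by
    intro b hb
    obtain ⟨g, rfl⟩ := orbitProj_eq_iff.1 hb
    exact ⟨g • x, orbitProj_smul g x, hequiv g x⟩
  -- The orbit of `x` is a fibre of a submersion, hence locally a chart slice, and `q` has constant
  -- rank `ρ` on such slices. Countability comes from `M`.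
  refine (ManifoldDimLE.of_locally fun y hy ↦ ?_).mono hfib
  obtain ⟨d, L, φ, ψ, hφ, hψ, hyφ, hsub, hL⟩ := hG.exists_normalForm y
  refine ⟨φ.source, φ.open_source.mem_nhds hyφ, ?_⟩
  let c := (L (φ y)).1
  have hc : ∀ t ∈ chartSliceSource L φ c,
      orbitProj G M (chartSlice L φ c t) = orbitProj G M x := by
    intro t ht
    have h1 := chartSlice_mem_source ht
    rw [← show orbitProj G M y = orbitProj G M x from hy]
    refine ψ.injOn (hsub _ h1) (hsub _ hyφ) ?_
    rw [hL _ h1, hL _ hyφ, apply_chartSlice ht]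
  have hslice := contMDiffOn_chartSlice (L := L) hφ c
  refine (manifoldDimLE_image_of_rank_eq (isOpen_chartSliceSource (L := L) (φ := φ) c)
    (hq.contMDiff'.comp_contMDiffOn hslice) (ρ := ρ) fun t ht ↦ ?_).mono ?_
  · have h1 : MDifferentiableAt (Mdl d) (Mdl n) (chartSlice L φ c) t :=
      (hslice.contMDiffAt ((isOpen_chartSliceSource c).mem_nhds ht)).mdifferentiableAt (by simp)
    have h2 := (hq.contMDiff'.contMDiffAt.mdifferentiableAt
      (x := chartSlice L φ c t) (by simp)).hasMFDerivAt.comp t h1.hasMFDerivAt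
    rw [← hrank _ (hc t ht), h2.mfderiv]
    let Q' : Euc n →L[ℝ] Euc m := mfderiv (Mdl n) (Mdl m) q (chartSlice L φ c t)
    let S : Euc d →L[ℝ] Euc n := mfderiv (Mdl d) (Mdl n) (chartSlice L φ c) t
    let O₁ : Euc n →L[ℝ] Euc k := mfderiv (Mdl n) (Mdl k) (orbitProj G M) (chartSlice L φ c t)
    have hS : S.toLinearMap.range = O₁.ker := by
      ext v
      exact (range_mfderiv_chartSlice hφ ht v).trans
        (mem_ker_mfderiv_iff_of_normalForm hG.contMDiff' hφ hψ hsub hL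
          (chartSlice_mem_source ht) v).symm
    change finrank ℝ (Q'.toLinearMap.comp S.toLinearMap).range =
      finrank ℝ (Submodule.map Q'.toLinearMap O₁.ker)
    rw [LinearMap.range_comp, hS]
  · rintro _ ⟨z, ⟨hz, hzφ⟩, rfl⟩
    have h1 : (L (φ z)).1 = c :=
      (hL z hzφ).symm.trans ((congrArg ψ (Eq.trans hz (Eq.symm hy))).trans (hL y hyφ))
    refine ⟨(L (φ z)).2, ?_, ?_⟩
    · have := mem_chartSliceSource (L := L) hzφ
      rwa [h1] at this
    · have := chartSlice_apply (L := L) hzφ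
      rw [h1] at this
      exact congrArg q this

/-- The map of orbit spaces induced by an equivariant submersion is a submersion. -/
theorem isSubmersion_orbitMap (hq : IsSubmersion (Mdl n) (Mdl m) ∞ q)
    (hG : IsSubmersion (Mdl n) (Mdl k) ∞ (orbitProj G M))
    (hG' : IsSubmersion (Mdl m) (Mdl i) ∞ (orbitProj G B))
    (hp : ∀ x, p (orbitProj G M x) = orbitProj G B (q x)) :
    IsSubmersion (Mdl k) (Mdl i) ∞ p := by
  refine IsSubmersion.of_mfderiv_surjective
    (contMDiff_orbitMap hq.contMDiff' hG hG'.contMDiff' hp) fun y ↦ ?_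
  obtain ⟨x, rfl⟩ := orbitProj_surjective G M y
  intro w
  obtain ⟨u, hu⟩ := hG'.mfderiv_surjective (q x) (show Euc i from w)
  obtain ⟨v, rfl⟩ := hq.mfderiv_surjective x u
  exact ⟨_, (mfderiv_orbitMap_apply hq.contMDiff' hG hG'.contMDiff' hp x v).trans hu⟩

/-- The kernel of the derivative of the map of orbit spaces induced by an equivariant submersion. -/
theorem ker_mfderiv_orbitMap [SecondCountableTopology M]
    (hq : IsSubmersion (Mdl n) (Mdl m) ∞ q)
    (hqs : Function.Surjective q) (hequiv : ∀ (g : G) x, q (g • x) = g • q x)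
    (hsm : ∀ g : G, ContMDiff (Mdl n) (Mdl n) ∞ fun x : M ↦ g • x)
    (hG : IsSubmersion (Mdl n) (Mdl k) ∞ (orbitProj G M))
    (hG' : IsSubmersion (Mdl m) (Mdl i) ∞ (orbitProj G B))
    (hp : ∀ x, p (orbitProj G M x) = orbitProj G B (q x)) (x : M) :
    (mfderiv (Mdl k) (Mdl i) p (orbitProj G M x)).ker =
    (mfderiv (Mdl n) (Mdl m) q x).ker.map
      (mfderiv (Mdl n) (Mdl k) (orbitProj G M) x).toLinearMap := by
  have hchain := mfderiv_orbitMap_apply hq.contMDiff' hG hG'.contMDiff' hp x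
  ext w
  constructor
  · intro hw
    obtain ⟨v, rfl⟩ := hG.mfderiv_surjective x w
    -- The image of `v` is tangent to the orbit in `B`, so it is also the image of some `u` tangent
    -- to the orbit in `M`; then `v - u` is killed by `dq` and still maps to `w`.
    have h1 : mfderiv (Mdl n) (Mdl m) q x v ∈
        (mfderiv (Mdl m) (Mdl i) (orbitProj G B) (q x)).ker := (hchain v).symm.trans hw
    rw [← map_ker_mfderiv_orbitProj hq hqs hequiv hsm hG hG' hp x] at h1
    obtain ⟨u, hu, huv⟩ := h1
    refine ⟨v - u, ?_, ?_⟩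
    · refine (map_sub (mfderiv (Mdl n) (Mdl m) q x) v u).trans ?_
      exact sub_eq_zero.2 huv.symm
    · refine (map_sub (mfderiv (Mdl n) (Mdl k) (orbitProj G M) x) v u).trans ?_
      have hu' : mfderiv (Mdl n) (Mdl k) (orbitProj G M) x u = 0 := hu
      rw [hu', sub_zero]
  · rintro ⟨v, hv, rfl⟩
    have hv' : mfderiv (Mdl n) (Mdl m) q x v = 0 := hv
    have h1 := hchain v
    rw [hv'] at h1
    exact h1.trans (map_zero _)

end EquivariantSubmersions

/-! ### Transport and uniqueness of quotient manifold structures -/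

section QuotientManifolds

/-- The charted space structure transported along a homeomorphism. -/
@[reducible]
def Homeomorph.pullbackChartedSpace {H X Y : Type*} [TopologicalSpace H] [TopologicalSpace X]
    [TopologicalSpace Y] [ChartedSpace H Y] (e : X ≃ₜ Y) : ChartedSpace H X where
  atlas := (fun c ↦ e.toOpenPartialHomeomorph.trans c) '' atlas H Y
  chartAt x := e.toOpenPartialHomeomorph.trans (chartAt H (e x))
  mem_chart_source x := by simp
  chart_mem_atlas x := ⟨_, chart_mem_atlas H (e x), rfl⟩

theorem Homeomorph.isManifold_pullbackChartedSpace {n : ℕ} {X Y : Type*} [TopologicalSpace X]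
    [TopologicalSpace Y] [ChartedSpace (Euc n) Y] [IsManifold (Mdl n) ∞ Y] (e : X ≃ₜ Y) :
    let _ : ChartedSpace (Euc n) X := e.pullbackChartedSpace
    IsManifold (Mdl n) ∞ X := by
  let _ : ChartedSpace (Euc n) X := e.pullbackChartedSpace
  have : HasGroupoid X (contDiffGroupoid ∞ (Mdl n)) := by
    refine ⟨?_⟩
    rintro _ _ ⟨c, hc, rfl⟩ ⟨c', hc', rfl⟩
    have h1 : e.toOpenPartialHomeomorph.symm.trans e.toOpenPartialHomeomorph =
        OpenPartialHomeomorph.refl Y := by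
      rw [← Homeomorph.symm_toOpenPartialHomeomorph, ← Homeomorph.trans_toOpenPartialHomeomorph,
        Homeomorph.symm_trans_self, Homeomorph.refl_toOpenPartialHomeomorph]
    have h2 : (e.toOpenPartialHomeomorph.trans c).symm.trans (e.toOpenPartialHomeomorph.trans c') =
        c.symm.trans c' := by
      rw [OpenPartialHomeomorph.trans_symm_eq_symm_trans_symm, OpenPartialHomeomorph.trans_assoc,
        ← OpenPartialHomeomorph.trans_assoc e.toOpenPartialHomeomorph.symm, h1,
        OpenPartialHomeomorph.refl_trans]
    rw [h2]
    exact HasGroupoid.compatible hc hc'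
  exact IsManifold.mk' _ _ _

variable {n : ℕ} {M : Type*} [TopologicalSpace M] [ChartedSpace (Euc n) M]
  [IsManifold (Mdl n) ∞ M]

/-- Quotient manifold structures can be transported along homeomorphisms. -/
theorem AdmitsQuotientManifold.of_homeomorph {Q Q' : Type*} [TopologicalSpace Q]
    [TopologicalSpace Q'] {q : M → Q} {q' : M → Q'} (e : Q' ≃ₜ Q) (he : ∀ x, e (q' x) = q x)
    (h : AdmitsQuotientManifold n q) : AdmitsQuotientManifold n q' := by
  obtain ⟨k, c, hq⟩ := h
  have := hq.isManifold
  have := hq.t2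
  let _ : ChartedSpace (Euc k) Q' := e.pullbackChartedSpace
  have hman : IsManifold (Mdl k) ∞ Q' := e.isManifold_pullbackChartedSpace
  have hchart : ∀ x : Q', e.toOpenPartialHomeomorph.trans (chartAt (Euc k) (e x)) ∈
      IsManifold.maximalAtlas (Mdl k) ∞ Q' := fun x ↦ IsManifold.chart_mem_maximalAtlas x
  have hsrc : ∀ x y : Q', e y ∈ (chartAt (Euc k) (e x)).source →
      y ∈ (e.toOpenPartialHomeomorph.trans (chartAt (Euc k) (e x))).source := by
    intro x y hy; simpa using hy
  -- In the transported charts, `e` is locally the identity.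
  let E : Q' ≃ₘ^∞⟮Mdl k, Mdl k⟯ Q :=
    { toEquiv := e.toEquiv
      contMDiff_toFun := by
        intro x
        have h1 := contMDiffAt_of_mem_maximalAtlas (hchart x) (hsrc x x (mem_chart_source _ _))
        have h2 := contMDiffAt_symm_of_mem_maximalAtlas
          (IsManifold.chart_mem_maximalAtlas (I := Mdl k) (n := ∞) (e x))
          (mem_chart_target (Euc k) (e x))
        refine (h2.comp x h1).congr_of_eventuallyEq ?_
        filter_upwards [e.continuous.continuousAt
          ((chartAt (Euc k) (e x)).open_source.mem_nhds (mem_chart_source _ (e x)))] with y hy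
        exact ((chartAt (Euc k) (e x)).left_inv hy).symm
      contMDiff_invFun := by
        intro y
        obtain ⟨x, rfl⟩ := e.surjective y
        have h1 := contMDiffAt_of_mem_maximalAtlas
          (IsManifold.chart_mem_maximalAtlas (I := Mdl k) (n := ∞) (e x))
          (mem_chart_source (Euc k) (e x))
        have h2 := contMDiffAt_symm_of_mem_maximalAtlas (hchart x)
          (x := chartAt (Euc k) (e x) (e x))
          ((e.toOpenPartialHomeomorph.trans (chartAt (Euc k) (e x))).map_source
            (hsrc x x (mem_chart_source _ _)))
        refine (h2.comp (e x) h1).congr_of_eventuallyEq ?_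
        filter_upwards [(chartAt (Euc k) (e x)).open_source.mem_nhds
          (mem_chart_source _ (e x))] with y hy
        exact congrArg e.symm ((chartAt (Euc k) (e x)).left_inv hy).symm }
  have hq' : q' = E.symm ∘ q := by
    ext x
    exact (e.symm_apply_eq.2 (he x).symm).symm
  refine ⟨k, inferInstance, ⟨e.symm.t2Space, hman, ?_⟩⟩
  rw [hq']
  refine IsSubmersion.of_mfderiv_surjective
    (E.symm.contMDiff.comp hq.isSubmersion.contMDiff') fun x ↦ ?_
  rw [mfderiv_comp x (E.symm.contMDiff.contMDiffAt.mdifferentiableAt (by simp))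
    (hq.isSubmersion.contMDiff'.contMDiffAt.mdifferentiableAt (by simp))]
  exact (E.symm.mfderivToContinuousLinearEquiv (by simp) (q x)).surjective.comp
    (hq.isSubmersion.mfderiv_surjective x)

/-- The identity composed with `q` is `q`, which is smooth for the second structure, and smoothness
descends along the submersion for the first. -/
theorem uniqueQuotientManifold_of_surjective {Q : Type*} [TopologicalSpace Q] {q : M → Q}
    (hq : Function.Surjective q) : UniqueQuotientManifold n q := by
  intro k k' c c' h h'
  have := h.isManifold
  exact h.isSubmersion.contMDiff_of_comp hq h'.isSubmersion.contMDiff'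

end QuotientManifolds

namespace TangentDistribution

/-! ### The vertical distribution of a submersion -/

section Vertical

variable {n i : ℕ} {M : Type u} [TopologicalSpace M] [ChartedSpace (Euc n) M]
  [IsManifold (Mdl n) ∞ M] {B : Type*} [TopologicalSpace B] [ChartedSpace (Euc i) B]
  [IsManifold (Mdl i) ∞ B] {Δ : TangentDistribution n M} {p : M → B}

/-- In the normal form the kernel is a fixed subspace of the model space, so a field with constant
coordinates extends a given vector inside `Δ`. -/
theorem isSmooth_of_eq_ker (hp : IsSubmersion (Mdl n) (Mdl i) ∞ p)
    (hΔ : ∀ x, (mfderiv (Mdl n) (Mdl i) p x).ker = Δ x) : Δ.IsSmooth := by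
  intro x v hv
  have : IsManifold (Mdl n) 1 M := IsManifold.of_le (n := ∞) (by simp)
  obtain ⟨d, L, φ, ψ, hφ, hψ, hx, hsub, hL⟩ := hp.exists_normalForm x
  have hφd := OpenPartialHomeomorph.mdifferentiable_of_mem_maximalAtlas hφ
  have hker := fun y hy v ↦
    mem_ker_mfderiv_iff_of_normalForm hp.contMDiff' hφ hψ hsub hL (y := y) hy v
  let w : Euc n := mfderiv (Mdl n) (Mdl n) φ x v
  have hcancel : ∀ y ∈ φ.source, ∀ u : Euc n, mfderiv (Mdl n) (Mdl n) φ y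
      (mfderivWithin (Mdl n) (Mdl n) φ.symm φ.target (φ y) u) = u := by
    intro y hy u
    have h1 : HasMFDerivAt (Mdl n) (Mdl n) φ.symm (φ y)
        (mfderivWithin (Mdl n) (Mdl n) φ.symm φ.target (φ y)) :=
      (hφd.symm.mdifferentiableAt (φ.map_source hy)).mdifferentiableWithinAt.hasMFDerivWithinAt
        |>.hasMFDerivAt (φ.open_target.mem_nhds (φ.map_source hy))
    have h2 : HasMFDerivAt (Mdl n) (Mdl n) φ (φ.symm (φ y)) (mfderiv (Mdl n) (Mdl n) φ y) := by
      rw [φ.left_inv hy]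
      exact (hφd.mdifferentiableAt hy).hasMFDerivAt
    have h3 : HasMFDerivAt (Mdl n) (Mdl n) (φ ∘ φ.symm) (φ y) (ContinuousLinearMap.id ℝ _) := by
      refine (hasMFDerivAt_id (φ y)).congr_of_eventuallyEq ?_
      filter_upwards [φ.open_target.mem_nhds (φ.map_source hy)] with z hz using φ.right_inv hz
    exact congrArg (fun A ↦ A u) (hasMFDerivAt_unique (h2.comp _ h1) h3)
  let X : (y : M) → TangentSpace (Mdl n) y := fun y ↦
    mfderivWithin (Mdl n) (Mdl n) φ.symm φ.target (φ y) w
  refine ⟨φ.source, φ.open_source, hx, X, ?_, ?_, ?_⟩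
  · have h1 := (contMDiffOn_symm_of_mem_maximalAtlas hφ).contMDiffOn_tangentMapWithin (m := ∞)
      (by simp) φ.open_target.uniqueMDiffOn
    have h2 : ContMDiff (Mdl n) (Mdl n).tangent ∞
        (fun z : Euc n ↦ (⟨z, w⟩ : TangentBundle (Mdl n) (Euc n))) :=
      contMDiff_vectorSpace_iff_contDiff.2 contDiff_const
    have h3 := h1.comp (h2.comp_contMDiffOn (contMDiffOn_of_mem_maximalAtlas hφ))
      (fun y hy ↦ φ.map_source hy)
    refine h3.congr fun y hy ↦ ?_
    have key : ∀ z, z = y → ∀ u : Euc n,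
        (⟨y, u⟩ : TangentBundle (Mdl n) M) = ⟨z, u⟩ := by
      rintro _ rfl u; rfl
    exact key _ (φ.left_inv hy) _
  · intro y hy
    rw [← hΔ]
    refine (hker y hy (X y)).2 ?_
    have h1 := (hker x hx v).1 (by rw [hΔ]; exact hv)
    have h2 : mfderiv (Mdl n) (Mdl n) φ y (X y) = w := hcancel y hy w
    rw [h2]
    exact h1
  · exact hφd.mfderiv_injective hx (hcancel x hx w)

theorem hasConstantRank_of_eq_ker (hp : IsSubmersion (Mdl n) (Mdl i) ∞ p)
    (hΔ : ∀ x, (mfderiv (Mdl n) (Mdl i) p x).ker = Δ x) : Δ.HasConstantRank := by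
  refine ⟨n - i, fun x ↦ ?_⟩
  rw [← hΔ]
  have := hp.finrank_ker x
  omega

/-- Locally, the fibres of a submersion are integral manifolds of its vertical distribution. -/
theorem exists_isIntegralManifold_fibre (hp : IsSubmersion (Mdl n) (Mdl i) ∞ p)
    (hΔ : ∀ x, (mfderiv (Mdl n) (Mdl i) p x).ker = Δ x) (x : M) :
    ∃ (d : ℕ) (N : Type u) (_ : TopologicalSpace N) (_ : ChartedSpace (Euc d) N) (f : N → M),
      Δ.IsIntegralManifold d N f ∧ ConnectedSpace N ∧ ∀ᶠ y in 𝓝 x, p y = p x → y ∈ range f := by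
  obtain ⟨d, L, φ, ψ, hφ, hψ, hx, hsub, hL⟩ := hp.exists_normalForm x
  have hker := fun y hy v ↦
    mem_ker_mfderiv_iff_of_normalForm hp.contMDiff' hφ hψ hsub hL (y := y) hy v
  let c := (L (φ x)).1
  let a := (L (φ x)).2
  obtain ⟨ε, hε, hball⟩ := Metric.isOpen_iff.1 (isOpen_chartSliceSource (L := L) (φ := φ) c) a
    (mem_chartSliceSource hx)
  obtain ⟨N, i1, i2, f, hf, hN, hrange⟩ := exists_isIntegralManifold_of_chartSlice (Δ := Δ) hφ
    Metric.isOpen_ball (Metric.isConnected_ball hε) hball (fun t ht ↦ by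
      rw [← hΔ]
      ext v
      exact (range_mfderiv_chartSlice hφ (hball ht) v).trans
        (hker _ (chartSlice_mem_source (hball ht)) v).symm)
  refine ⟨d, N, i1, i2, f, hf, hN, ?_⟩
  have hc : ContinuousAt (fun y ↦ (L (φ y)).2) x :=
    continuous_snd.continuousAt.comp (L.continuous.continuousAt.comp (φ.continuousAt hx))
  filter_upwards [φ.open_source.mem_nhds hx, hc (Metric.ball_mem_nhds a hε)] with y hy hyb hpy
  rw [hrange]
  refine ⟨(L (φ y)).2, hyb, ?_⟩
  have h1 : (L (φ y)).1 = c := by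
    rw [← hL y hy, hpy, hL x hx]
  rw [← h1]
  exact chartSlice_apply hy

theorem isIntegrable_of_eq_ker (hp : IsSubmersion (Mdl n) (Mdl i) ∞ p)
    (hΔ : ∀ x, (mfderiv (Mdl n) (Mdl i) p x).ker = Δ x) : Δ.IsIntegrable := by
  intro x
  obtain ⟨d, N, i1, i2, f, hf, -, hev⟩ := exists_isIntegralManifold_fibre hp hΔ x
  exact ⟨d, N, i1, i2, f, hf, hev.self_of_nhds rfl⟩

theorem eventually_onCommon_of_eq_ker (hp : IsSubmersion (Mdl n) (Mdl i) ∞ p)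
    (hΔ : ∀ x, (mfderiv (Mdl n) (Mdl i) p x).ker = Δ x) (x : M) :
    ∀ᶠ y in 𝓝 x, p y = p x → Δ.OnCommonIntegralManifold x y := by
  obtain ⟨d, N, i1, i2, f, hf, hN, hev⟩ := exists_isIntegralManifold_fibre hp hΔ x
  filter_upwards [hev] with y hy hpy
  exact ⟨d, N, i1, i2, f, hf, hN, hev.self_of_nhds rfl, hy hpy⟩

omit [IsManifold (Mdl n) ∞ M] in
/-- A submersion is constant along the leaves of its vertical distribution. -/
theorem apply_eq_of_leafSetoid (hp : ContMDiff (Mdl n) (Mdl i) ∞ p)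
    (hΔ : ∀ x, (mfderiv (Mdl n) (Mdl i) p x).ker = Δ x) {x y : M} (h : Δ.leafSetoid x y) :
    p x = p y := by
  induction h with
  | rel a b h =>
    obtain ⟨r, N, i1, i2, f, hf, hN, ⟨w, rfl⟩, ⟨w', rfl⟩⟩ := h
    refine hf.apply_eq hp (fun x v hv ↦ ?_) w w'
    rw [← hΔ] at hv
    exact hv
  | refl => rfl
  | symm _ _ _ ih => exact ih.symm
  | trans _ _ _ _ _ ih₁ ih₂ => exact ih₁.trans ih₂

/-- A continuous map from a connected space into a fibre of a submersion stays in one leaf of the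
vertical distribution. -/
theorem leafSetoid_of_apply_eq (hp : IsSubmersion (Mdl n) (Mdl i) ∞ p)
    (hΔ : ∀ x, (mfderiv (Mdl n) (Mdl i) p x).ker = Δ x) {N : Type*} [TopologicalSpace N]
    [ConnectedSpace N] {f : N → M} (hf : Continuous f) (hc : ∀ y z, p (f y) = p (f z)) (y z : N) :
    Δ.leafSetoid (f y) (f z) := by
  -- Nearby points of one fibre lie on a common connected integral manifold.
  have hloc : IsLocallyConstant (Δ.leafProj ∘ f) := by
    rw [IsLocallyConstant.iff_eventually_eq]
    intro w
    filter_upwards [hf.continuousAt.eventually (eventually_onCommon_of_eq_ker hp hΔ (f w))]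
      with w' hw'
    exact (Quotient.sound (Relation.EqvGen.rel _ _ (hw' (hc w' w)))).symm
  exact Quotient.exact (hloc.apply_eq_of_preconnectedSpace y z)

end Vertical

end TangentDistribution

/-! ### The distribution Δ/G and its leaf space -/

namespace TangentDistribution

theorem leafProj_surjective {n : ℕ} {M : Type u} [TopologicalSpace M] [ChartedSpace (Euc n) M]
    (Δ : TangentDistribution n M) : Function.Surjective Δ.leafProj := Quotient.mk_surjective

theorem descend_surjective {n : ℕ} {G : Type*} [Group G] {M : Type u} [TopologicalSpace M]
    [ChartedSpace (Euc n) M] [IsManifold (Mdl n) ∞ M] [MulAction G M]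
    {Δ : TangentDistribution n M} [Δ.IsInvariant G] : Function.Surjective (Δ.descend G) := by
  intro b
  obtain ⟨s, rfl⟩ := orbitProj_surjective G Δ.LeafSpace b
  obtain ⟨x, rfl⟩ := Δ.leafProj_surjective s
  exact ⟨orbitProj G M x, rfl⟩

variable {n m k i : ℕ} {G : Type*} [Group G] {M : Type u} [TopologicalSpace M]
  [ChartedSpace (Euc n) M] [IsManifold (Mdl n) ∞ M] [SecondCountableTopology M] [MulAction G M]
  {Δ : TangentDistribution n M} [hinv : Δ.IsInvariant G]
  [ChartedSpace (Euc m) Δ.LeafSpace] [IsManifold (Mdl m) ∞ Δ.LeafSpace]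
  [ChartedSpace (Euc k) (MulAction.orbitRel.Quotient G M)]
  [IsManifold (Mdl k) ∞ (MulAction.orbitRel.Quotient G M)]
  [ChartedSpace (Euc i) (MulAction.orbitRel.Quotient G Δ.LeafSpace)]
  [IsManifold (Mdl i) ∞ (MulAction.orbitRel.Quotient G Δ.LeafSpace)]

/-- The distribution `Δ/G` is the kernel of the derivative of `M/G → (M/Δ)/G`. -/
theorem ker_mfderiv_descend (hsmooth : Δ.IsSmooth) (hint : Δ.IsIntegrable)
    (hq : IsSubmersion (Mdl n) (Mdl m) ∞ Δ.leafProj)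
    (hG : IsSubmersion (Mdl n) (Mdl k) ∞ (orbitProj G M))
    (hG' : IsSubmersion (Mdl m) (Mdl i) ∞ (orbitProj G Δ.LeafSpace))
    (y : MulAction.orbitRel.Quotient G M) :
    (mfderiv (Mdl k) (Mdl i) (Δ.descend G) y).ker = Δ.quotient G k y := by
  have hker : ∀ x, (mfderiv (Mdl k) (Mdl i) (Δ.descend G) (orbitProj G M x)).ker =
      (Δ x).map (mfderiv (Mdl n) (Mdl k) (orbitProj G M) x).toLinearMap := by
    intro x
    rw [ker_mfderiv_orbitMap hq Δ.leafProj_surjective (leafProj_smul Δ) hinv.contMDiff hG hG'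
      (descend_orbitProj Δ) x, ker_mfderiv_leafProj hsmooth hint hq x]
  refine le_antisymm ?_ ?_
  · obtain ⟨x, rfl⟩ := orbitProj_surjective G M y
    rw [hker]
    rintro _ ⟨v, hv, rfl⟩
    exact Submodule.subset_span ⟨x, v, hv, rfl⟩
  -- The span runs over all representatives `x` of `y`; `hker` identifies the image of `Δ x` with
  -- the same kernel for each of them.
  · refine Submodule.span_le.2 ?_
    rintro w ⟨x, v, hv, hw⟩
    have hy : orbitProj G M x = y := congrArg Bundle.TotalSpace.proj hw
    subst hy
    have hw' : mfderiv (Mdl n) (Mdl k) (orbitProj G M) x v = w :=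
      eq_of_heq (Bundle.TotalSpace.mk.inj hw).2
    rw [← hw', SetLike.mem_coe, hker]
    exact ⟨v, hv, rfl⟩

/-- The leaves of `Δ/G` are the fibres of `M/G → (M/Δ)/G`. -/
theorem leafProj_quotient_eq_iff (hsmooth : Δ.IsSmooth) (hint : Δ.IsIntegrable)
    (hq : IsSubmersion (Mdl n) (Mdl m) ∞ Δ.leafProj)
    (hG : IsSubmersion (Mdl n) (Mdl k) ∞ (orbitProj G M))
    (hG' : IsSubmersion (Mdl m) (Mdl i) ∞ (orbitProj G Δ.LeafSpace))
    (y z : MulAction.orbitRel.Quotient G M) :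
    (Δ.quotient G k).leafProj y = (Δ.quotient G k).leafProj z ↔
      Δ.descend G y = Δ.descend G z := by
  have hker := ker_mfderiv_descend hsmooth hint hq hG hG'
  have hp : IsSubmersion (Mdl k) (Mdl i) ∞ (Δ.descend G) :=
    isSubmersion_orbitMap hq hG hG' (descend_orbitProj Δ)
  -- A connected integral manifold of `Δ` is mapped to M/G continuously and into one fibre of p,
  -- hence into one leaf of Δ/G.
  have hleaf : ∀ {a b : M}, Δ.leafSetoid a b →
      (Δ.quotient G k).leafSetoid (orbitProj G M a) (orbitProj G M b) := by
    intro a b h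
    induction h with
    | rel a b h =>
      obtain ⟨r, N, i1, i2, f, hf, hN, ⟨w, rfl⟩, ⟨w', rfl⟩⟩ := h
      refine leafSetoid_of_apply_eq hp hker (f := orbitProj G M ∘ f)
        (hG.contMDiff'.continuous.comp hf.isImmersion.contMDiff'.continuous) (fun w w' ↦ ?_) w w'
      simp only [Function.comp_apply, descend_orbitProj]
      exact congrArg _ (Quotient.sound (Relation.EqvGen.rel _ _
        ⟨r, N, i1, i2, f, hf, hN, ⟨w, rfl⟩, ⟨w', rfl⟩⟩))
    | refl x => exact Relation.EqvGen.refl _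
    | symm _ _ _ ih => exact Relation.EqvGen.symm _ _ ih
    | trans _ _ _ _ _ ih₁ ih₂ => exact Relation.EqvGen.trans _ _ _ ih₁ ih₂
  constructor
  · exact fun h ↦ apply_eq_of_leafSetoid hp.contMDiff' hker (Quotient.exact h)
  · intro h
    obtain ⟨a, rfl⟩ := orbitProj_surjective G M y
    obtain ⟨b, rfl⟩ := orbitProj_surjective G M z
    rw [descend_orbitProj, descend_orbitProj] at h
    -- Moving `b` within its orbit brings it into the leaf of `a`.
    obtain ⟨g, hg⟩ := orbitProj_eq_iff.1 h
    have h1 : Δ.leafSetoid (g • b) a := Quotient.exact hg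
    rw [← orbitProj_smul g b]
    exact (Quotient.sound (hleaf h1)).symm

/-- The leaf space of `Δ/G` is homeomorphic to `(M/Δ)/G`. -/
theorem exists_homeomorph_leafSpace_quotient (hsmooth : Δ.IsSmooth) (hint : Δ.IsIntegrable)
    (hq : IsSubmersion (Mdl n) (Mdl m) ∞ Δ.leafProj)
    (hG : IsSubmersion (Mdl n) (Mdl k) ∞ (orbitProj G M))
    (hG' : IsSubmersion (Mdl m) (Mdl i) ∞ (orbitProj G Δ.LeafSpace)) :
    ∃ e : (Δ.quotient G k).LeafSpace ≃ₜ MulAction.orbitRel.Quotient G Δ.LeafSpace,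
      ∀ y, e ((Δ.quotient G k).leafProj y) = Δ.descend G y := by
  have hiff := leafProj_quotient_eq_iff hsmooth hint hq hG hG'
  have hp : IsSubmersion (Mdl k) (Mdl i) ∞ (Δ.descend G) :=
    isSubmersion_orbitMap hq hG hG' (descend_orbitProj Δ)
  let e : (Δ.quotient G k).LeafSpace → MulAction.orbitRel.Quotient G Δ.LeafSpace :=
    Quotient.lift (Δ.descend G) fun y z h ↦ (hiff y z).1 (Quotient.sound h)
  have he : ∀ y, e ((Δ.quotient G k).leafProj y) = Δ.descend G y := fun y ↦ rfl
  have hbij : Function.Bijective e := by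
    constructor
    · intro a b hab
      obtain ⟨y, rfl⟩ := leafProj_surjective _ a
      obtain ⟨z, rfl⟩ := leafProj_surjective _ b
      exact (hiff y z).2 hab
    · intro b
      obtain ⟨y, rfl⟩ := descend_surjective b
      exact ⟨_, he y⟩
  have hcont : Continuous e := hp.contMDiff'.continuous.quotient_lift _
  -- Openness is inherited from the submersion p.
  have hopen : IsOpenMap e := by
    intro U hU
    have h1 : e '' U = Δ.descend G '' ((Δ.quotient G k).leafProj ⁻¹' U) := by
      ext b
      constructor
      · rintro ⟨a, ha, rfl⟩
        obtain ⟨y, rfl⟩ := leafProj_surjective _ a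
        exact ⟨y, ha, rfl⟩
      · rintro ⟨y, hy, rfl⟩
        exact ⟨_, hy, rfl⟩
    rw [h1]
    exact hp.isOpenMap _ (hU.preimage continuous_quot_mk)
  exact ⟨(Equiv.ofBijective e hbij).toHomeomorphOfContinuousOpen hcont hopen, he⟩

end TangentDistribution

end

/-! ### The main theorem -/

open TangentDistribution

theorem mainTheorem5 {l n : ℕ}
    -- a Lie group `G` acting smoothly on a manifold `M`
    {G : Type*} [Group G] [TopologicalSpace G] [ChartedSpace (Euc l) G] [LieGroup (Mdl l) ∞ G]
    {M : Type*} [TopologicalSpace M] [T2Space M] [SecondCountableTopology M]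
    [ChartedSpace (Euc n) M] [IsManifold (Mdl n) ∞ M]
    [MulAction G M] [ContMDiffSMul (Mdl l) (Mdl n) ∞ G M]
    -- a regular integrable distribution `Δ`, preserved by `G`
    (Δ : TangentDistribution n M) (hsmooth : Δ.IsSmooth) (hint : Δ.IsIntegrable)
    (hreg : Δ.IsRegular) [Δ.IsInvariant G]
    -- the manifold `M/Δ`
    {m : ℕ} [ChartedSpace (Euc m) Δ.LeafSpace] (hleaf : IsQuotientManifold n m Δ.leafProj)
    -- `G` acts regularly on `M` and on `M/Δ`
    (hG : IsRegularAction G n M) (hG' : IsRegularAction G m Δ.LeafSpace)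
    -- the manifold `M/G`
    {k : ℕ} [ChartedSpace (Euc k) (MulAction.orbitRel.Quotient G M)]
    [IsManifold (Mdl k) ∞ (MulAction.orbitRel.Quotient G M)]
    (horb : IsQuotientManifold n k (orbitProj G M)) :
    -- `Δ/G` is a distribution of constant rank on `M/G`, integrable and regular
    ((Δ.quotient G k).IsSmooth ∧ (Δ.quotient G k).HasConstantRank ∧
      (Δ.quotient G k).IsIntegrable ∧ (Δ.quotient G k).IsRegular) ∧
    -- for the manifold structures on `(M/Δ)/G` and `(M/G)/(Δ/G)`
    ∀ (i j : ℕ) [ChartedSpace (Euc i) (MulAction.orbitRel.Quotient G Δ.LeafSpace)]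
      [ChartedSpace (Euc j) (Δ.quotient G k).LeafSpace],
      IsQuotientManifold m i (orbitProj G Δ.LeafSpace) →
      IsQuotientManifold k j (Δ.quotient G k).leafProj →
      -- there is a unique diffeomorphism `τ` compatible with the projections
      ∃! τ : MulAction.orbitRel.Quotient G Δ.LeafSpace ≃ₘ^∞⟮Mdl i, Mdl j⟯
          (Δ.quotient G k).LeafSpace,
        (∀ x : M, τ (orbitProj G Δ.LeafSpace (Δ.leafProj x)) =
          (Δ.quotient G k).leafProj (orbitProj G M x)) ∧
        τ.symm ∘ (Δ.quotient G k).leafProj = Δ.descend G := by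
  have := hleaf.isManifold
  have hq := hleaf.isSubmersion
  have hqG := horb.isSubmersion
  constructor
  -- The assertions on Δ/G do not involve the manifold (M/Δ)/G, so any structure provided by
  -- regularity serves.
  · obtain ⟨i, c, hi⟩ := hG'
    have := hi.isManifold
    have hqG' := hi.isSubmersion
    have hp : IsSubmersion (Mdl k) (Mdl i) ∞ (Δ.descend G) :=
      isSubmersion_orbitMap hq hqG hqG' (descend_orbitProj Δ)
    have hker := ker_mfderiv_descend hsmooth hint hq hqG hqG'
    obtain ⟨e, he⟩ := exists_homeomorph_leafSpace_quotient hsmooth hint hq hqG hqG'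
    refine ⟨isSmooth_of_eq_ker hp hker, hasConstantRank_of_eq_ker hp hker,
      isIntegrable_of_eq_ker hp hker, ?_,
      uniqueQuotientManifold_of_surjective (leafProj_surjective _)⟩
    exact AdmitsQuotientManifold.of_homeomorph e he ⟨i, c, hi.t2, hi.isManifold, hp⟩
  · intro i j ci cj hi hj
    have := hi.isManifold
    have := hj.isManifold
    have hqG' := hi.isSubmersion
    have hp : IsSubmersion (Mdl k) (Mdl i) ∞ (Δ.descend G) :=
      isSubmersion_orbitMap hq hqG hqG' (descend_orbitProj Δ)
    obtain ⟨e, he⟩ := exists_homeomorph_leafSpace_quotient hsmooth hint hq hqG hqG'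
    have he' : ∀ y, e.symm (Δ.descend G y) = (Δ.quotient G k).leafProj y := fun y ↦
      e.symm_apply_eq.2 (he y).symm
    -- Both directions are smooth because they become the two projections after composition with
    -- surjective submersions from M/G.
    let τ : MulAction.orbitRel.Quotient G Δ.LeafSpace ≃ₘ^∞⟮Mdl i, Mdl j⟯
        (Δ.quotient G k).LeafSpace :=
      { toEquiv := e.symm.toEquiv
        contMDiff_toFun := by
          refine hp.contMDiff_of_comp descend_surjective ?_
          have h1 : e.symm.toEquiv ∘ Δ.descend G = (Δ.quotient G k).leafProj := funext he'
          have h2 := hj.isSubmersion.contMDiff'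
          rwa [← h1] at h2
        contMDiff_invFun := by
          refine hj.isSubmersion.contMDiff_of_comp (leafProj_surjective _) ?_
          have h1 : e.symm.toEquiv.symm ∘ (Δ.quotient G k).leafProj = Δ.descend G := funext he
          have h2 := hp.contMDiff'
          rwa [← h1] at h2 }
    refine ⟨τ, ⟨fun x ↦ he' (orbitProj G M x), funext he⟩, fun τ' hτ' ↦ ?_⟩
    -- Compatibility on `M` determines τ, because `M` surjects onto (M/Δ)/G.
    ext b
    obtain ⟨s, rfl⟩ := orbitProj_surjective G Δ.LeafSpace b
    obtain ⟨x, rfl⟩ := leafProj_surjective _ s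
    exact (hτ'.1 x).trans (he' (orbitProj G M x)).symm
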